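/- Let $V_1,V_2,\dots$ be i.i.d. standard normal random variables, let $s>0$ and $p\ge 1$ be fixed, and let $X_0=0$, $X_t=\sum_{i=1}^t V_i+st$ for integers $t\ge 1$. For a threshold $\ell\ge 0$ let $\tau_\ell=\inf\{t\ge 0: X_t\ge \ell\}$. For an integer delay $d\ge 0$ the observations are $Y_0=\dots=Y_d=0$ and $Y_t=X_{t-d}$ for $t\ge d+1$. Let $\inf_\eta$ denote the infimum over all stopping times $\eta$ with respect to the natural filtration of $Y=\{Y_t\}_{t\ge 0}$, and let $$\eta^*_d=\inf\{t\ge d: Y_t\ge \ell-s d\},$$ which coincides with $\inf\{t\ge 0: Y_t\ge \ell-sd\}$ whenever $\ell>sd$. Let $\ell=\ell(d)$ be any function of $d$ with $\ell(d)\ge s d$ for all $d$. Then, as $d\to\infty$ through the integers, $$\inf_\eta \mathbb{E}|\eta-\tau_\ell|^p=(1+o(1))\,\mathbb{E}|\eta^*_d-\tau_\ell|^p=(1+o(1))\,\frac{d^{p/2}}{s^p}\,\mathbb{E}|N|^p ,$$ where $N$ is a standard normal random variable. In particular, if $\ell(d)>sd$ for all large $d$, the same holds with $\inf\{t\ge 0: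 Y_t\ge \ell-sd\}$ in place of $\eta^*_d$. -/

import Mathlib

open MeasureTheory ProbabilityTheory Filter Topology
open scoped ENNReal

namespace DelayedTracking

variable {Ω : Type*}

/-- The random walk with drift `s` and increments `V`: `X_0 = 0` and
`X_t = V_1 + ... + V_t + s t`. The increment written `V_{i+1}` is `V i` here. -/
def walk (V : ℕ → Ω → ℝ) (s : ℝ) (t : ℕ) (ω : Ω) : ℝ :=
  (∑ i ∈ Finset.range t, V i ω) + s * t

/-- The observations delayed by `d`: `Y_0 = ... = Y_d = 0` and `Y_t = X_{t-d}` for `t ≥ d + 1`. -/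
def delayed (V : ℕ → Ω → ℝ) (s : ℝ) (d : ℕ) (t : ℕ) (ω : Ω) : ℝ :=
  if t ≤ d then 0 else walk V s (t - d) ω

/-- The first-passage time `τ_ℓ = inf {t ≥ 0 : X_t ≥ ℓ}` (infinite if there is no such `t`). -/
noncomputable def passageTime (V : ℕ → Ω → ℝ) (s ℓ : ℝ) : Ω → WithTop ℕ :=
  hittingAfter (walk V s) (Set.Ici ℓ) 0

/-- The first time `t ≥ m` at which the delayed observation satisfies `Y_t ≥ ℓ - s d`. -/
noncomputable def delayedRuleFrom (m : ℕ) (V : ℕ → Ω → ℝ) (s ℓ : ℝ) (d : ℕ) : Ω → WithTop ℕ :=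
  hittingAfter (delayed V s d) (Set.Ici (ℓ - s * d)) m

/-- The distance `|a - b|` of two extended natural numbers, with `|∞ - n| = |n - ∞| = ∞` for
finite `n`. Subtraction in `ℝ≥0∞` is truncated, so at most one of the summands is nonzero. -/
noncomputable def absDiff (a b : ℕ∞) : ℝ≥0∞ :=
  ((a : ℝ≥0∞) - (b : ℝ≥0∞)) + ((b : ℝ≥0∞) - (a : ℝ≥0∞))

variable [MeasurableSpace Ω]

/-- The error `E |η - τ_ℓ| ^ p`, as a value in `[0, ∞]`. -/
noncomputable def trackingError (P : Measure Ω) (V : ℕ → Ω → ℝ) (s ℓ p : ℝ)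
    (η : Ω → WithTop ℕ) : ℝ≥0∞ :=
  ∫⁻ ω, absDiff (η ω) (passageTime V s ℓ ω) ^ p ∂P

lemma measurable_walk {V : ℕ → Ω → ℝ} (hV : ∀ i, Measurable (V i)) (s : ℝ) (t : ℕ) :
    Measurable (walk V s t) :=
  (Finset.measurable_fun_sum _ fun i _ => hV i).add_const _

lemma stronglyMeasurable_delayed {V : ℕ → Ω → ℝ} (hV : ∀ i, Measurable (V i)) (s : ℝ)
    (d t : ℕ) : StronglyMeasurable (delayed V s d t) := by
  refine Measurable.stronglyMeasurable ?_
  unfold delayed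
  split_ifs
  · exact measurable_const
  · exact measurable_walk hV s (t - d)

/-- The natural filtration of the delayed observations, `σ(Y_0, ..., Y_t)` at time `t`. -/
noncomputable def observationFiltration {V : ℕ → Ω → ℝ} (hV : ∀ i, Measurable (V i)) (s : ℝ)
    (d : ℕ) : Filtration ℕ (inferInstance : MeasurableSpace Ω) :=
  Filtration.natural (delayed V s d) (stronglyMeasurable_delayed hV s d)

/-- The optimal error `inf_η E |η - τ_ℓ| ^ p`, over all stopping times `η` of the natural
filtration of the delayed observations. -/
noncomputable def optimalError (P : Measure Ω) {V : ℕ → Ω → ℝ} (hV : ∀ i, Measurable (V i))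
    (s ℓ p : ℝ) (d : ℕ) : ℝ≥0∞ :=
  ⨅ (η : Ω → WithTop ℕ) (_ : IsStoppingTime (observationFiltration hV s d) η),
    trackingError P V s ℓ p η

/-- The constant `C_2(d, s, p) = (d ^ (p / 2) / s ^ p) E |N| ^ p`, where `N` is standard normal. -/
noncomputable def gaussianError (d : ℕ) (s p : ℝ) : ℝ≥0∞ :=
  ENNReal.ofReal ((d : ℝ) ^ (p / 2) / s ^ p) * ∫⁻ x, ENNReal.ofReal |x| ^ p ∂(gaussianReal 0 1)

/-- `a d = (1 + o(1)) b d` as `d → ∞`, as convergence of the ratio to `1`. Division in `ℝ≥0∞`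
makes this fail unless `a d` and `b d` are positive and finite for all large `d`. -/
def AsympEq (a b : ℕ → ℝ≥0∞) : Prop :=
  Tendsto (fun d => a d / b d) atTop (𝓝 1)

end DelayedTracking

/-!
Write `N` for a standard normal variable, `σ` for the passage time of the level `ℓ - s d` and `τ`
for that of `ℓ`. The delayed rule is `σ + d`. Over the `d` unobserved steps before a rule stops, the
walk moves by `s d` plus a centred Gaussian variable of variance `d`, independent of everything the
rule knows. As the drift is `s` per step, a height which is off by `√d N` means a passage which is
off by `√d N / s` steps; the fluctuations of the walk over the order of `√d` steps around the
passage are only of order `d ^ (1 / 4)`. So the error of any rule should be at least, and that of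
the delayed rule about, `(√d / s) |N - c|`, with a shift `c` known to the rule and equal to `0` for
the delayed rule. The choice `c = 0` is the best one, in the strong sense that no interval of a
given length has more Gaussian mass than the centred one (`gaussianReal_Icc_le_centralMass`).

The proof compares tail probabilities at every scale `x √d` and integrates them with the layer cake
formula, so that no moment inequality for the walk is needed.

* No rule is within `x √d` steps of `τ` with probability larger than `P(|N| ≤ s x) + o(1)`,
  uniformly in the rule and in `ℓ` (`eventually_measure_absDiff_le`). Whether a stopping time of the
  delayed observations takes the value `t` is decided by the first `t - d` steps (by nothing, if
  `t ≤ d`). If `τ` is in the window of radius `x √d` around `t`, then the position at the start of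
  the window lies in an interval of length about `2 s x √d` below `ℓ`, and given the decision this
  position is Gaussian of variance about `d`.
* The delayed rule misses `τ` by more than `x √d` steps with probability at most
  `2 P(N ≥ s x) + o(1)` (`eventually_measure_rule_le`), and these probabilities decay exponentially
  in `x`, uniformly in `d` and `ℓ` (`measure_rule_le_exp`). Here the overshoot of the walk over the
  level `ℓ - s d` enters. It has Gaussian tails whatever the level is (`measure_overshoot_le`),
  because a Gaussian variable which exceeds a nonnegative level is unlikely to exceed it by much.

Both parts have to bound the probability of an early passage by that of a high position at a fixed
time, without losing the factor `2` of the reflection principle. This is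
`measure_passageTime_le_mul`: after its passage the walk drifts upwards, so `q` steps later it is
still above the level with probability at least `P(N ≥ -s √q)`, which tends to `1` as `q → ∞`.

Since `P(|N| > s x) = 2 P(N ≥ s x)`, dominated convergence (`tendsto_tailMoment`) shows that the
normalized moments of the delayed rule, and those formed from the infimum of the tail probabilities
over all rules, have the same limit `E |N| ^ p / s ^ p`. The optimal error is between the two.
-/

namespace DelayedTracking

/-! ### Tails of the standard normal law -/

/-- The upper tail `y ↦ P(N ≥ y)` of the standard normal law. -/
noncomputable def upperTail (y : ℝ) : ℝ≥0∞ := gaussianReal 0 1 (Set.Ici y)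

/-- The mass `y ↦ P(|N| ≤ y)` which the standard normal law puts around its centre. -/
noncomputable def centralMass (y : ℝ) : ℝ≥0∞ := gaussianReal 0 1 (Set.Icc (-y) y)

lemma upperTail_anti : Antitone upperTail := fun _ _ h => measure_mono (Set.Ici_subset_Ici.2 h)

lemma centralMass_mono : Monotone centralMass := fun _ _ h =>
  measure_mono (Set.Icc_subset_Icc (neg_le_neg h) h)

lemma upperTail_le_one (y : ℝ) : upperTail y ≤ 1 := prob_le_one

lemma upperTail_ne_top (y : ℝ) : upperTail y ≠ ∞ := measure_ne_top _ _

lemma ae_gaussianReal_ne (y : ℝ) : ∀ᵐ x ∂(gaussianReal 0 1), x ≠ y := by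
  have := nullSingletonClass_gaussianReal (μ := 0) (v := 1) one_ne_zero
  exact Measure.ae_ne _ y

lemma continuous_upperTail : Continuous upperTail := by
  refine continuous_iff_continuousAt.2 fun y => ?_
  refine tendsto_measure_of_ae_tendsto_indicator_of_isFiniteMeasure _ measurableSet_Ici
    (fun _ => measurableSet_Ici) ?_
  filter_upwards [ae_gaussianReal_ne y] with x hx
  rcases lt_or_gt_of_ne hx with h | h
  · filter_upwards [lt_mem_nhds h] with z hz
    simp [h.not_ge, hz.not_ge]
  · filter_upwards [gt_mem_nhds h] with z hz
    simp [h.le, hz.le]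

lemma gaussianReal_Iic_neg (y : ℝ) : gaussianReal 0 1 (Set.Iic (-y)) = upperTail y := by
  have h : (gaussianReal 0 1).map (fun x : ℝ => -x) = gaussianReal 0 1 := by
    simpa using gaussianReal_map_neg (μ := 0) (v := 1)
  rw [← h, Measure.map_apply measurable_neg measurableSet_Iic, upperTail]
  congr 1
  ext x
  simp

/-- A standard normal variable exceeds `y` in absolute value with probability `2 P(N ≥ y)`. -/
lemma gaussianReal_lt_abs {y : ℝ} (hy : 0 ≤ y) :
    gaussianReal 0 1 {x : ℝ | y < |x|} = 2 * upperTail y := by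
  have h1 : gaussianReal 0 1 {x : ℝ | y < |x|} =
      gaussianReal 0 1 (Set.Iic (-y) ∪ Set.Ici y \ {y}) := by
    refine measure_congr ?_
    filter_upwards [ae_gaussianReal_ne y, ae_gaussianReal_ne (-y)] with x hx hx'
    refine propext ?_
    change y < |x| ↔ x ≤ -y ∨ (y ≤ x ∧ x ≠ y)
    rw [lt_abs]
    constructor
    · rintro (h | h)
      · exact Or.inr ⟨h.le, hx⟩
      · exact Or.inl (by linarith)
    · rintro (h | h)
      · exact Or.inr (by linarith [lt_of_le_of_ne h hx'])
      · exact Or.inl (lt_of_le_of_ne h.1 hx.symm)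
  have := nullSingletonClass_gaussianReal (μ := 0) (v := 1) one_ne_zero
  rw [h1, measure_union _ (measurableSet_Ici.diff (measurableSet_singleton y)),
    gaussianReal_Iic_neg, measure_sdiff_null (measure_singleton y), two_mul]
  · rfl
  · rw [Set.disjoint_left]
    rintro x hx ⟨hx1, hx2⟩
    simp only [Set.mem_Iic, Set.mem_Ici, Set.mem_singleton_iff] at *
    exact hx2 (by linarith)

/-- The central mass is the complement of the two tails. -/
lemma centralMass_eq {y : ℝ} (hy : 0 ≤ y) : centralMass y = 1 - 2 * upperTail y := by
  rw [← gaussianReal_lt_abs hy, centralMass, ← prob_compl_eq_one_sub₀]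
  · congr 1
    ext x
    simp [abs_le]
  · exact (measurableSet_lt measurable_const measurable_id.abs).nullMeasurableSet

lemma two_mul_upperTail_le_one {y : ℝ} (hy : 0 ≤ y) : 2 * upperTail y ≤ 1 :=
  (gaussianReal_lt_abs hy).symm.trans_le prob_le_one

lemma upperTail_neg_add (y : ℝ) : upperTail (-y) + upperTail y = 1 := by
  have := nullSingletonClass_gaussianReal (μ := 0) (v := 1) one_ne_zero
  rw [upperTail, ← gaussianReal_Iic_neg, ← Set.compl_Iio, measure_congr Iio_ae_eq_Iic.compl,
    add_comm, measure_add_measure_compl measurableSet_Iic, measure_univ]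

lemma upperTail_zero : upperTail 0 = 2⁻¹ := by
  have h := upperTail_neg_add 0
  rw [neg_zero, ← two_mul] at h
  exact ENNReal.eq_inv_of_mul_eq_one_left (by rwa [mul_comm])

lemma half_le_upperTail_neg {y : ℝ} (hy : 0 ≤ y) : 2⁻¹ ≤ upperTail (-y) :=
  upperTail_zero.symm.trans_le (upperTail_anti (neg_nonpos.2 hy))

lemma upperTail_neg_ne_zero {y : ℝ} (hy : 0 ≤ y) : upperTail (-y) ≠ 0 :=
  ((ENNReal.inv_pos.2 ENNReal.ofNat_ne_top).trans_le (half_le_upperTail_neg hy)).ne'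

/-- Each shift by `ρ ≥ 0` to the right of the origin costs the tail a factor `exp (-ρ² / 2)`. -/
lemma upperTail_add_le {z ρ : ℝ} (hz : 0 ≤ z) (hρ : 0 ≤ ρ) :
    upperTail (z + ρ) ≤ ENNReal.ofReal (Real.exp (-ρ ^ 2 / 2)) * upperTail z := by
  have h1 : upperTail (z + ρ) = ∫⁻ x in Set.Ici z, gaussianPDF 0 1 (x + ρ) := by
    rw [upperTail, gaussianReal_apply _ one_ne_zero, ← lintegral_indicator measurableSet_Ici,
      ← lintegral_indicator measurableSet_Ici, ← lintegral_add_right_eq_self _ ρ]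
    congr 1 with x
    simp [Set.indicator_apply]
  rw [h1, upperTail, gaussianReal_apply _ one_ne_zero,
    ← lintegral_const_mul _ (measurable_gaussianPDF 0 1)]
  refine setLIntegral_mono ((measurable_gaussianPDF 0 1).const_mul _) fun x hx => ?_
  have hx' : 0 ≤ x := hz.trans hx
  rw [gaussianPDF, gaussianPDF, ← ENNReal.ofReal_mul (Real.exp_nonneg _)]
  refine ENNReal.ofReal_le_ofReal ?_
  simp only [gaussianPDFReal, sub_zero]
  rw [mul_left_comm, ← Real.exp_add]
  gcongr
  norm_num
  nlinarith [mul_nonneg hx' hρ]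

lemma upperTail_le_exp {ρ : ℝ} (hρ : 0 ≤ ρ) :
    upperTail ρ ≤ ENNReal.ofReal (Real.exp (-ρ ^ 2 / 2)) := by
  have h := upperTail_add_le le_rfl hρ
  rw [zero_add] at h
  exact h.trans (mul_le_of_le_one_right' (upperTail_le_one 0))

lemma tendsto_upperTail_atTop : Tendsto upperTail atTop (𝓝 0) := by
  have h : Tendsto (fun ρ : ℝ => ENNReal.ofReal (Real.exp (-ρ ^ 2 / 2))) atTop (𝓝 0) := by
    rw [← ENNReal.ofReal_zero]
    refine ENNReal.tendsto_ofReal (Real.tendsto_exp_atBot.comp ?_)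
    simp_rw [neg_div]
    exact tendsto_neg_atTop_atBot.comp ((tendsto_pow_atTop two_ne_zero).atTop_div_const two_pos)
  refine tendsto_of_tendsto_of_tendsto_of_le_of_le' tendsto_const_nhds h
    (Eventually.of_forall fun _ => zero_le) ?_
  filter_upwards [eventually_ge_atTop 0] with ρ hρ using upperTail_le_exp hρ

lemma tendsto_upperTail_atBot : Tendsto upperTail atBot (𝓝 1) := by
  have h : upperTail = fun y => 1 - upperTail (-y) := by
    ext y
    rw [← upperTail_neg_add y, ENNReal.add_sub_cancel_left (upperTail_ne_top _)]
  rw [h]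
  simpa using ENNReal.Tendsto.sub tendsto_const_nhds
    (tendsto_upperTail_atTop.comp tendsto_neg_atBot_atTop) (Or.inl ENNReal.one_ne_top)

lemma tendsto_centralMass {ι : Type*} {L : Filter ι} {f : ι → ℝ} {y : ℝ} (hy : 0 < y)
    (hf : Tendsto f L (𝓝 y)) : Tendsto (fun i => centralMass (f i)) L (𝓝 (centralMass y)) := by
  rw [centralMass_eq hy.le]
  refine Tendsto.congr' ?_ (ENNReal.Tendsto.sub tendsto_const_nhds (ENNReal.Tendsto.const_mul
    ((continuous_upperTail.tendsto y).comp hf) (Or.inr ENNReal.ofNat_ne_top))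
    (Or.inl ENNReal.one_ne_top))
  filter_upwards [hf.eventually (lt_mem_nhds hy)] with i hi
  rw [centralMass_eq hi.le]; rfl

/-- Among all intervals of a given length, the centred one carries the most Gaussian mass. -/
lemma gaussianReal_Icc_le_centralMass (c r : ℝ) :
    gaussianReal 0 1 (Set.Icc (c - r) (c + r)) ≤ centralMass r := by
  rcases lt_or_ge r 0 with hr | hr
  · rw [Set.Icc_eq_empty (by linarith), measure_empty]
    exact zero_le
  wlog hc : 0 ≤ c generalizing c
  · have h : (gaussianReal 0 1).map (fun x : ℝ => -x) = gaussianReal 0 1 := by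
      simpa using gaussianReal_map_neg (μ := 0) (v := 1)
    refine le_trans (le_of_eq ?_) (this (-c) (by linarith))
    conv_lhs => rw [← h, Measure.map_apply measurable_neg measurableSet_Icc]
    congr 1
    ext x
    simp only [Set.mem_preimage, Set.mem_Icc]
    constructor <;> rintro ⟨h1, h2⟩ <;> constructor <;> linarith
  have hcont : Continuous (gaussianPDFReal 0 1) := by
    unfold gaussianPDFReal
    fun_prop
  have hi : ∀ a b, IntervalIntegrable (gaussianPDFReal 0 1) volume a b :=
    fun a b => hcont.intervalIntegrable a b
  rw [centralMass, gaussianReal_apply_eq_integral _ one_ne_zero,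
    gaussianReal_apply_eq_integral _ one_ne_zero]
  refine ENNReal.ofReal_le_ofReal ?_
  rw [integral_Icc_eq_integral_Ioc, integral_Icc_eq_integral_Ioc,
    ← intervalIntegral.integral_of_le (by linarith),
    ← intervalIntegral.integral_of_le (by linarith)]
  -- Moving the interval by `c` gains the mass of `[r, r + c]` and loses that of `[-r, -r + c]`.
  have e1 : ∫ x in (0 : ℝ)..c, gaussianPDFReal 0 1 (x + r) =
      ∫ x in r..c + r, gaussianPDFReal 0 1 x := by
    rw [intervalIntegral.integral_comp_add_right, zero_add]
  have e2 : ∫ x in (0 : ℝ)..c, gaussianPDFReal 0 1 (x - r) =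
      ∫ x in (-r)..c - r, gaussianPDFReal 0 1 x := by
    rw [intervalIntegral.integral_comp_sub_right, zero_sub]
  have e3 := intervalIntegral.integral_add_adjacent_intervals (hi (-r) (c - r)) (hi (c - r) (c + r))
  have e4 := intervalIntegral.integral_add_adjacent_intervals (hi (-r) r) (hi r (c + r))
  have e5 : ∫ x in (0 : ℝ)..c, gaussianPDFReal 0 1 (x + r) ≤
      ∫ x in (0 : ℝ)..c, gaussianPDFReal 0 1 (x - r) := by
    refine intervalIntegral.integral_mono_on hc
      ((hcont.comp (by fun_prop)).intervalIntegrable _ _)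
      ((hcont.comp (by fun_prop)).intervalIntegrable _ _) fun x hx => ?_
    refine mul_le_mul_of_nonneg_left (Real.exp_le_exp.2 ?_) (by positivity)
    norm_num
    nlinarith [mul_nonneg hx.1 hr]
  linarith

/-! ### Centred normal laws of integer variance -/

lemma gaussianReal_natCast (h : ℕ) :
    gaussianReal 0 (h : NNReal) = (gaussianReal 0 1).map (fun x : ℝ => √h * x) := by
  rw [gaussianReal_map_const_mul]
  congr 1
  · simp
  · ext
    simp

lemma gaussianReal_natCast_Ici {h : ℕ} (hh : h ≠ 0) (y : ℝ) :
    gaussianReal 0 (h : NNReal) (Set.Ici y) = upperTail (y / √h) := by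
  have hp : 0 < √(h : ℝ) := Real.sqrt_pos.2 (by positivity)
  rw [gaussianReal_natCast h, Measure.map_apply (by fun_prop) measurableSet_Ici, upperTail]
  congr 1
  ext x
  simp [div_le_iff₀' hp]

lemma gaussianReal_natCast_Iic {h : ℕ} (hh : h ≠ 0) (y : ℝ) :
    gaussianReal 0 (h : NNReal) (Set.Iic (-y)) = upperTail (y / √h) := by
  have hp : 0 < √(h : ℝ) := Real.sqrt_pos.2 (by positivity)
  rw [gaussianReal_natCast h, Measure.map_apply (by fun_prop) measurableSet_Iic,
    ← gaussianReal_Iic_neg]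
  congr 1
  ext x
  simp only [Set.mem_preimage, Set.mem_Iic]
  rw [← neg_div, le_div_iff₀' hp]

lemma gaussianReal_natCast_Icc_le {h : ℕ} (hh : h ≠ 0) (c w : ℝ) :
    gaussianReal 0 (h : NNReal) (Set.Icc c (c + w)) ≤ centralMass (w / (2 * √h)) := by
  have hp : 0 < √(h : ℝ) := Real.sqrt_pos.2 (by positivity)
  rw [gaussianReal_natCast h, Measure.map_apply (by fun_prop) measurableSet_Icc]
  refine le_trans (measure_mono ?_)
    (gaussianReal_Icc_le_centralMass ((c + w / 2) / √h) (w / (2 * √h)))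
  have e1 : (c + w / 2) / √h - w / (2 * √h) = c / √h := by field_simp; ring
  have e2 : (c + w / 2) / √h + w / (2 * √h) = (c + w) / √h := by field_simp; ring
  rintro x ⟨h1, h2⟩
  rw [e1, e2]
  exact ⟨(div_le_iff₀' hp).2 h1, (le_div_iff₀' hp).2 h2⟩

/-! ### The past of the walk and its independent increments -/

section Walk

variable {Ω : Type*} {V : ℕ → Ω → ℝ} {s ℓ : ℝ}

/-- The driftless increment `V_{k+1} + ... + V_{k+h}` of the walk from time `k` to `k + h`. -/
def increment (V : ℕ → Ω → ℝ) (k h : ℕ) (ω : Ω) : ℝ := ∑ i ∈ Finset.Ico k (k + h), V i ω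

/-- The σ-algebra generated by the first `k` steps of the walk. -/
abbrev past (V : ℕ → Ω → ℝ) (k : ℕ) : MeasurableSpace Ω :=
  ⨆ i ∈ Set.Iio k, MeasurableSpace.comap (V i) inferInstance

lemma walk_add (k h : ℕ) (ω : Ω) :
    walk V s (k + h) ω = walk V s k ω + s * h + increment V k h ω := by
  simp only [walk, increment, ← Finset.sum_range_add_sum_Ico _ (Nat.le_add_right k h)]
  push_cast
  ring

lemma walk_zero (ω : Ω) : walk V s 0 ω = 0 := by simp [walk]

lemma past_mono : Monotone (past V) := fun _ _ h => biSup_mono fun _ hi => lt_of_lt_of_le hi h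

lemma measurable_walk_past (k : ℕ) : Measurable[past V k] (walk V s k) := by
  refine Measurable.add_const (Finset.measurable_fun_sum _ fun i hi => ?_) _
  exact (comap_measurable (V i)).mono
    (le_biSup (fun i => MeasurableSpace.comap (V i) inferInstance)
      (Set.mem_Iio.2 (Finset.mem_range.1 hi))) le_rfl

lemma measurable_walk_past_of_le {k n : ℕ} (h : k ≤ n) : Measurable[past V n] (walk V s k) :=
  (measurable_walk_past k).mono (past_mono h) le_rfl

lemma passageTime_le_iff {t : ℕ} {ω : Ω} :
    passageTime V s ℓ ω ≤ t ↔ ∃ j ≤ t, ℓ ≤ walk V s j ω := by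
  change hittingAfter (walk V s) (Set.Ici ℓ) 0 ω ≤ WithTop.some t ↔ _
  rw [hittingAfter_le_iff]
  simp

lemma le_walk_of_passageTime_eq {t : ℕ} {ω : Ω} (h : passageTime V s ℓ ω = t) :
    ℓ ≤ walk V s t ω := by
  obtain ⟨j, hj, hj'⟩ := passageTime_le_iff.1 h.le
  obtain rfl | hlt := hj.eq_or_lt
  · exact hj'
  · have : (t : WithTop ℕ) ≤ j := h ▸ passageTime_le_iff.2 ⟨j, le_rfl, hj'⟩
    exact absurd (by exact_mod_cast this) hlt.not_ge

lemma walk_lt_of_lt_passageTime {t : ℕ} {ω : Ω} (h : (t : WithTop ℕ) < passageTime V s ℓ ω) :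
    walk V s t ω < ℓ := by
  by_contra! h'
  exact h.not_ge (passageTime_le_iff.2 ⟨t, le_rfl, h'⟩)

lemma measurableSet_passageTime_le (t : ℕ) :
    MeasurableSet[past V t] {ω | passageTime V s ℓ ω ≤ t} := by
  have : {ω | passageTime V s ℓ ω ≤ t} = ⋃ j ∈ Set.Iic t, {ω | ℓ ≤ walk V s j ω} := by
    ext ω
    simp [passageTime_le_iff]
  rw [this]
  refine MeasurableSet.biUnion (Set.to_countable _) fun j hj => ?_
  exact measurable_walk_past_of_le hj measurableSet_Ici

/-- To pass the level at time `k + 1` is to have missed it up to time `k` and to be above it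
at time `k + 1`. -/
lemma passageTime_eq_succ_iff {k : ℕ} {ω : Ω} :
    passageTime V s ℓ ω = (k + 1 : ℕ) ↔
      ω ∈ {ω | passageTime V s ℓ ω ≤ k}ᶜ ∩ {ω | ℓ ≤ walk V s (k + 1) ω} := by
  constructor
  · intro h
    refine ⟨?_, le_walk_of_passageTime_eq h⟩
    simp only [Set.mem_compl_iff, Set.mem_ofPred_eq, h]
    exact_mod_cast Nat.not_succ_le_self k
  · rintro ⟨h1, h2⟩
    simp only [Set.mem_compl_iff, Set.mem_ofPred_eq, not_le] at h1
    refine le_antisymm (passageTime_le_iff.2 ⟨k + 1, le_rfl, h2⟩) ?_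
    exact Order.add_one_le_of_lt (α := ℕ∞) h1

lemma measurableSet_passageTime_eq (t : ℕ) :
    MeasurableSet[past V t] {ω | passageTime V s ℓ ω = t} := by
  cases t with
  | zero =>
    convert measurableSet_passageTime_le (V := V) (s := s) (ℓ := ℓ) 0 using 3
    simp
  | succ k =>
    have : {ω | passageTime V s ℓ ω = (k + 1 : ℕ)} =
        {ω | passageTime V s ℓ ω ≤ k}ᶜ ∩ {ω | ℓ ≤ walk V s (k + 1) ω} := by
      ext ω
      exact passageTime_eq_succ_iff
    rw [this]
    exact (past_mono k.le_succ _ (measurableSet_passageTime_le k).compl).inter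
      (measurable_walk_past (k + 1) measurableSet_Ici)

end Walk

/-- The steps `V_1, V_2, ...` are independent standard normal variables. -/
structure IsStandardNoise {Ω : Type*} [MeasurableSpace Ω] (P : Measure Ω) (V : ℕ → Ω → ℝ) :
    Prop where
  measurable : ∀ i, Measurable (V i)
  indep : iIndepFun V P
  law : ∀ i, HasLaw (V i) (gaussianReal 0 1) P

section Noise

variable {Ω : Type*} [MeasurableSpace Ω] {P : Measure Ω} {V : ℕ → Ω → ℝ} {s ℓ : ℝ}

namespace IsStandardNoise

lemma past_le (hN : IsStandardNoise P V) (k : ℕ) : past V k ≤ ‹MeasurableSpace Ω› :=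
  iSup₂_le fun i _ => (hN.measurable i).comap_le

lemma measurable_increment (hN : IsStandardNoise P V) (k h : ℕ) : Measurable (increment V k h) :=
  Finset.measurable_fun_sum _ fun i _ => hN.measurable i

lemma measurableSet_eq (hN : IsStandardNoise P V) (t : ℕ) :
    MeasurableSet {ω | passageTime V s ℓ ω = t} :=
  hN.past_le t _ (measurableSet_passageTime_eq t)

lemma indep_past_increment (hN : IsStandardNoise P V) (k h : ℕ) :
    Indep (past V k) (MeasurableSpace.comap (increment V k h) inferInstance) P := by
  have h1 : Indep (past V k) (⨆ i ∈ Set.Ici k, MeasurableSpace.comap (V i) inferInstance) P :=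
    indep_iSup_of_disjoint (fun i => (hN.measurable i).comap_le) hN.indep
      (Set.disjoint_left.2 fun x hx hx' => (Set.mem_Iio.1 hx).not_ge hx')
  refine indep_of_indep_of_le_right h1 (Measurable.comap_le ?_)
  refine Finset.measurable_fun_sum _ fun i hi => ?_
  exact (comap_measurable (V i)).mono
    (le_biSup (fun i => MeasurableSpace.comap (V i) inferInstance)
      (Set.mem_Ici.2 (Finset.mem_Ico.1 hi).1)) le_rfl

variable [IsProbabilityMeasure P]

lemma map_increment (hN : IsStandardNoise P V) (k h : ℕ) :
    P.map (increment V k h) = gaussianReal 0 (h : NNReal) := by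
  induction h with
  | zero =>
    have : increment V k 0 = fun _ => 0 := by ext; simp [increment]
    rw [this, Measure.map_const]
    simp
  | succ h ih =>
    have e : increment V k (h + 1) = (∑ i ∈ Finset.Ico k (k + h), V i) + V (k + h) := by
      ext ω
      rw [increment, ← add_assoc, Finset.sum_Ico_succ_top (Nat.le_add_right k h)]
      simp
    have e' : increment V k h = ∑ i ∈ Finset.Ico k (k + h), V i := by
      ext ω
      simp [increment]
    rw [e, gaussianReal_add_gaussianReal_of_indepFun
      (hN.indep.indepFun_finsetSum_of_notMem hN.measurable (by simp)) (e' ▸ ih)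
      (hN.law (k + h)).map_eq]
    simp

/-- Conditioning on the past: on a past event, a past variable stays fixed while the increment
is integrated out against its Gaussian law. -/
lemma measure_inter_past (hN : IsStandardNoise P V) {k : ℕ} (h : ℕ) {A : Set Ω}
    (hA : MeasurableSet[past V k] A) {Z : Ω → ℝ} (hZ : Measurable[past V k] Z)
    {S : Set (ℝ × ℝ)} (hS : MeasurableSet S) :
    P (A ∩ {ω | (Z ω, increment V k h ω) ∈ S}) =
      ∫⁻ ω in A, gaussianReal 0 (h : NNReal) (Prod.mk (Z ω) ⁻¹' S) ∂P := by
  have hZ' : Measurable Z := hZ.mono (hN.past_le k) le_rfl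
  have hA' : MeasurableSet A := hN.past_le k _ hA
  have hpair : Measurable fun ω => (Z ω, increment V k h ω) :=
    hZ'.prodMk (hN.measurable_increment k h)
  have key : ((P.restrict A).map Z).prod (gaussianReal 0 (h : NNReal)) =
      (P.restrict A).map fun ω => (Z ω, increment V k h ω) := by
    refine Measure.prod_eq fun B C hB hC => ?_
    rw [Measure.map_apply hpair (hB.prod hC), Measure.map_apply hZ' hB,
      Measure.restrict_apply (hpair (hB.prod hC)), Measure.restrict_apply (hZ' hB),
      ← hN.map_increment k h, Measure.map_apply (hN.measurable_increment k h) hC,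
      ← (Indep_iff _ _ _).1 (hN.indep_past_increment k h) _ _ ((hZ hB).inter hA) ⟨C, hC, rfl⟩]
    congr 1
    ext ω
    simp only [Set.mem_inter_iff, Set.mem_preimage, Set.mem_prod]
    tauto
  have : P (A ∩ {ω | (Z ω, increment V k h ω) ∈ S}) =
      (P.restrict A).map (fun ω => (Z ω, increment V k h ω)) S := by
    rw [Measure.map_apply hpair hS, Measure.restrict_apply (hpair hS), Set.inter_comm]
    rfl
  rw [this, ← key, Measure.prod_apply hS, lintegral_map (measurable_measure_prodMk_left hS) hZ']

lemma measure_inter_past_le (hN : IsStandardNoise P V) {k : ℕ} (h : ℕ) {A : Set Ω}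
    (hA : MeasurableSet[past V k] A) {Z : Ω → ℝ} (hZ : Measurable[past V k] Z)
    {S : Set (ℝ × ℝ)} (hS : MeasurableSet S) {c : ℝ≥0∞}
    (hc : ∀ z, gaussianReal 0 (h : NNReal) (Prod.mk z ⁻¹' S) ≤ c) :
    P (A ∩ {ω | (Z ω, increment V k h ω) ∈ S}) ≤ P A * c := by
  rw [hN.measure_inter_past h hA hZ hS, mul_comm, ← setLIntegral_const]
  exact lintegral_mono fun ω => hc _

lemma measure_inter_increment (hN : IsStandardNoise P V) {k : ℕ} (h : ℕ) {A : Set Ω}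
    (hA : MeasurableSet[past V k] A) {C : Set ℝ} (hC : MeasurableSet C) :
    P (A ∩ {ω | increment V k h ω ∈ C}) = P A * gaussianReal 0 (h : NNReal) C := by
  rw [← hN.map_increment k h, Measure.map_apply (hN.measurable_increment k h) hC]
  exact (Indep_iff _ _ _).1 (hN.indep_past_increment k h) _ _ hA ⟨C, hC, rfl⟩

end IsStandardNoise

variable [IsProbabilityMeasure P]

/-- A driftless Gaussian increment over `h ≤ q` steps is at least `-s h` with probability at least
`P(N ≥ -s √q)`. -/
lemma upperTail_le_gaussianReal_Ici (hs : 0 ≤ s) {h q : ℕ} (hq : q ≤ h) :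
    upperTail (-(s * √q)) ≤ gaussianReal 0 (h : NNReal) (Set.Ici (-(s * h))) := by
  rcases Nat.eq_zero_or_pos h with rfl | hpos
  · simpa using upperTail_le_one _
  · rw [gaussianReal_natCast_Ici hpos.ne', neg_div, mul_div_assoc, Real.div_sqrt]
    exact upperTail_anti (neg_le_neg (by gcongr))

/-- Once above the level, the walk is still above it at least `q` steps later with probability at
least `P(N ≥ -s √q)`, because of its positive drift. This bounds the probability of an early
passage by that of a high position at a fixed time. -/
lemma IsStandardNoise.measure_passageTime_le_mul (hN : IsStandardNoise P V) (hs : 0 ≤ s)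
    {B : Set Ω} {t : ℕ}
    (hB : ∀ j ≤ t, MeasurableSet[past V j] (B ∩ {ω | passageTime V s ℓ ω = j})) (q : ℕ) :
    P (B ∩ {ω | passageTime V s ℓ ω ≤ t}) * upperTail (-(s * √q)) ≤
      P (B ∩ {ω | ℓ ≤ walk V s (t + q) ω}) := by
  have hdisj : Set.PairwiseDisjoint (Finset.range (t + 1) : Set ℕ)
      fun j => B ∩ {ω | passageTime V s ℓ ω = j} := by
    intro i _ j _ hij
    refine Set.disjoint_left.2 fun ω hi hj => hij ?_
    exact_mod_cast hi.2.symm.trans hj.2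
  have hmeas : ∀ j ∈ Finset.range (t + 1), MeasurableSet (B ∩ {ω | passageTime V s ℓ ω = j}) :=
    fun j hj => hN.past_le j _ (hB j (Finset.mem_range_succ_iff.1 hj))
  have hwalk : MeasurableSet {ω | ℓ ≤ walk V s (t + q) ω} :=
    measurable_walk hN.measurable s (t + q) measurableSet_Ici
  have e1 : B ∩ {ω | passageTime V s ℓ ω ≤ t} =
      ⋃ j ∈ Finset.range (t + 1), B ∩ {ω | passageTime V s ℓ ω = j} := by
    ext ω
    simp only [Set.mem_inter_iff, Set.mem_ofPred_eq, Set.mem_iUnion, Finset.mem_range_succ_iff,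
      exists_prop]
    constructor
    · rintro ⟨hω, hle⟩
      obtain ⟨j, hj⟩ := WithTop.ne_top_iff_exists.1 (hle.trans_lt (WithTop.coe_lt_top t)).ne
      rw [← hj] at hle
      exact ⟨j, WithTop.coe_le_coe.1 hle, hω, hj.symm⟩
    · rintro ⟨j, hj, hω, hj'⟩
      rw [hj']
      exact ⟨hω, by exact_mod_cast hj⟩
  rw [e1, measure_biUnion_finset hdisj hmeas, Finset.sum_mul]
  calc ∑ j ∈ Finset.range (t + 1), P (B ∩ {ω | passageTime V s ℓ ω = j}) * upperTail (-(s * √q))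
      ≤ ∑ j ∈ Finset.range (t + 1),
          P ((B ∩ {ω | passageTime V s ℓ ω = j}) ∩ {ω | ℓ ≤ walk V s (t + q) ω}) := by
        refine Finset.sum_le_sum fun j hj => ?_
        have hjt : j ≤ t := Finset.mem_range_succ_iff.1 hj
        have hh : q ≤ t + q - j := by omega
        calc P (B ∩ {ω | passageTime V s ℓ ω = j}) * upperTail (-(s * √q))
            ≤ P (B ∩ {ω | passageTime V s ℓ ω = j}) *
                gaussianReal 0 ((t + q - j : ℕ) : NNReal) (Set.Ici (-(s * (t + q - j : ℕ)))) := by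
              gcongr
              exact upperTail_le_gaussianReal_Ici hs hh
          _ = P ((B ∩ {ω | passageTime V s ℓ ω = j}) ∩
                {ω | increment V j (t + q - j) ω ∈ Set.Ici (-(s * (t + q - j : ℕ)))}) :=
              (hN.measure_inter_increment _ (hB j hjt) measurableSet_Ici).symm
          _ ≤ _ := by
              refine measure_mono ?_
              rintro ω ⟨h1, h2⟩
              have h3 := le_walk_of_passageTime_eq h1.2
              have h4 := walk_add (V := V) (s := s) j (t + q - j) ω
              rw [Nat.add_sub_cancel' (by omega : j ≤ t + q)] at h4
              refine ⟨h1, ?_⟩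
              simp only [Set.mem_ofPred_eq, Set.mem_Ici] at h2 ⊢
              linarith
    _ = P (⋃ j ∈ Finset.range (t + 1),
          (B ∩ {ω | passageTime V s ℓ ω = j}) ∩ {ω | ℓ ≤ walk V s (t + q) ω}) := by
        refine (measure_biUnion_finset ?_ fun j hj => (hmeas j hj).inter hwalk).symm
        exact fun i hi j hj hij => (hdisj hi hj hij).mono Set.inter_subset_left
          Set.inter_subset_left
    _ ≤ P (B ∩ {ω | ℓ ≤ walk V s (t + q) ω}) := by
        refine measure_mono (Set.iUnion₂_subset fun j _ => ?_)
        exact Set.inter_subset_inter_left _ Set.inter_subset_left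

/-- The overshoot over a level `a ≥ 0` has Gaussian tails, uniformly in `a`: given that a step
carries the walk over the level, it does so by more than `ρ + s` with small probability. -/
lemma IsStandardNoise.measure_overshoot_le (hN : IsStandardNoise P V) (hs : 0 < s) {a ρ : ℝ}
    (ha : 0 ≤ a) (hρ : 0 ≤ ρ) (k : ℕ) :
    P ({ω | passageTime V s a ω = k} ∩ {ω | a + ρ + s ≤ walk V s k ω}) ≤
      P {ω | passageTime V s a ω = k} * ENNReal.ofReal (Real.exp (-ρ ^ 2 / 2)) := by
  cases k with
  | zero =>
    have : {ω | a + ρ + s ≤ walk V s 0 ω} = ∅ := by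
      ext ω
      simp only [walk_zero, Set.mem_ofPred_eq, Set.mem_empty_iff_false, iff_false]
      linarith
    simp [this]
  | succ k =>
    set A : Set Ω := {ω | passageTime V s a ω ≤ k}ᶜ
    have hA : MeasurableSet[past V k] A := (measurableSet_passageTime_le k).compl
    have hZ : Measurable[past V k] (walk V s k) := measurable_walk_past k
    -- A level at height `y + a` is cleared exactly when the step from height `z` is at least
    -- `y + a - s - z`.
    let S : ℝ → Set (ℝ × ℝ) := fun y => {x | y + a ≤ x.1 + s + x.2}
    have hS : ∀ y, MeasurableSet (S y) := fun y =>
      measurableSet_le measurable_const ((measurable_fst.add_const _).add measurable_snd)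
    have hw : ∀ ω, walk V s (k + 1) ω = walk V s k ω + s + increment V k 1 ω := fun ω => by
      rw [walk_add]; simp
    have hslice : ∀ y z, gaussianReal 0 ((1 : ℕ) : NNReal) (Prod.mk z ⁻¹' S y) =
        upperTail (y + a - s - z) := by
      intro y z
      rw [upperTail, Nat.cast_one]
      congr 1
      ext x
      simp only [S, Set.mem_preimage, Set.mem_ofPred_eq, Set.mem_Ici]
      constructor <;> intro h <;> linarith
    have e1 : {ω | passageTime V s a ω = (k + 1 : ℕ)} =
        A ∩ {ω | (walk V s k ω, increment V k 1 ω) ∈ S 0} := by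
      ext ω
      simp only [Set.mem_ofPred_eq, passageTime_eq_succ_iff, Set.mem_inter_iff, hw, S, zero_add, A]
    have e2 : {ω | passageTime V s a ω = (k + 1 : ℕ)} ∩ {ω | a + ρ + s ≤ walk V s (k + 1) ω} ⊆
        A ∩ {ω | (walk V s k ω, increment V k 1 ω) ∈ S (ρ + s)} := by
      rintro ω ⟨h1, h2⟩
      refine ⟨(passageTime_eq_succ_iff.1 h1).1, ?_⟩
      simp only [Set.mem_ofPred_eq, hw, S] at h2 ⊢
      linarith
    refine (measure_mono e2).trans ?_
    rw [e1, hN.measure_inter_past 1 hA hZ (hS _), hN.measure_inter_past 1 hA hZ (hS _), mul_comm,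
      ← lintegral_const_mul' _ _ ENNReal.ofReal_ne_top]
    refine setLIntegral_mono' (hN.past_le k _ hA) fun ω hω => ?_
    have hlt : walk V s k ω < a := walk_lt_of_lt_passageTime (not_le.1 hω)
    rw [hslice, hslice]
    calc upperTail (ρ + s + a - s - walk V s k ω) = upperTail ((a - walk V s k ω) + ρ) := by
          congr 1; ring
      _ ≤ ENNReal.ofReal (Real.exp (-ρ ^ 2 / 2)) * upperTail (a - walk V s k ω) :=
          upperTail_add_le (by linarith) hρ
      _ ≤ _ := by
          gcongr
          exact upperTail_anti (by linarith)

/-- A bound on the conditional probability of `E` given each finite value of a random time is a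
bound on the probability of `E`, if the time is almost surely finite on `E`. -/
lemma measure_le_of_forall_time_eq {η : Ω → WithTop ℕ}
    (hη : ∀ c : ℕ, MeasurableSet {ω | η ω = c}) {E : Set Ω} {b : ℝ≥0∞}
    (htop : P (E ∩ {ω | η ω = ⊤}) = 0)
    (h : ∀ c : ℕ, P ({ω | η ω = c} ∩ E) ≤ P {ω | η ω = c} * b) : P E ≤ b := by
  have hsub : E ⊆ (⋃ c : ℕ, {ω | η ω = c} ∩ E) ∪ (E ∩ {ω | η ω = ⊤}) := by
    intro ω hω
    by_cases hc : η ω = ⊤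
    · exact Or.inr ⟨hω, hc⟩
    · obtain ⟨c, hc⟩ := WithTop.ne_top_iff_exists.1 hc
      exact Or.inl (Set.mem_iUnion.2 ⟨c, hc.symm, hω⟩)
  have hdisj : Pairwise (Function.onFun Disjoint fun c : ℕ => {ω | η ω = c}) := by
    intro i j hij
    refine Set.disjoint_left.2 fun ω hi hj => hij ?_
    exact_mod_cast (hi : η ω = i).symm.trans hj
  calc P E ≤ P (⋃ c : ℕ, {ω | η ω = c} ∩ E) + 0 :=
        (measure_mono hsub).trans ((measure_union_le _ _).trans (by rw [htop]))
    _ ≤ ∑' c : ℕ, P ({ω | η ω = c} ∩ E) := by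
        rw [add_zero]
        exact measure_iUnion_le _
    _ ≤ ∑' c : ℕ, P {ω | η ω = c} * b := ENNReal.tsum_le_tsum h
    _ = P (⋃ c : ℕ, {ω | η ω = c}) * b := by
        rw [ENNReal.tsum_mul_right, measure_iUnion hdisj hη]
    _ ≤ b := mul_le_of_le_one_left' prob_le_one

lemma IsStandardNoise.measure_passageTime_eq_top (hN : IsStandardNoise P V) (hs : 0 < s) :
    P {ω | passageTime V s ℓ ω = ⊤} = 0 := by
  have hle : ∀ n : ℕ, n ≠ 0 →
      P {ω | passageTime V s ℓ ω = ⊤} ≤ upperTail ((s * n - ℓ) / √n) := by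
    intro n hn
    rw [← gaussianReal_natCast_Iic hn, ← hN.map_increment 0 n,
      Measure.map_apply (hN.measurable_increment 0 n) measurableSet_Iic]
    refine measure_mono fun ω hω => ?_
    have h1 : walk V s n ω < ℓ := walk_lt_of_lt_passageTime (by
      rw [show passageTime V s ℓ ω = ⊤ from hω]; exact WithTop.coe_lt_top n)
    have h2 := walk_add (V := V) (s := s) 0 n ω
    rw [zero_add, walk_zero] at h2
    simp only [Set.mem_preimage, Set.mem_Iic]
    linarith
  have hlim : Tendsto (fun n : ℕ => (s * n - ℓ) / √n) atTop atTop := by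
    have h1 : Tendsto (fun n : ℕ => √(n : ℝ)) atTop atTop :=
      Real.tendsto_sqrt_atTop.comp tendsto_natCast_atTop_atTop
    have h2 : Tendsto (fun n : ℕ => s * √n + (-ℓ) * (√n)⁻¹) atTop atTop :=
      (h1.const_mul_atTop hs).atTop_add ((tendsto_inv_atTop_zero.comp h1).const_mul (-ℓ))
    refine h2.congr' ?_
    filter_upwards [eventually_gt_atTop 0] with n hn
    have : (0 : ℝ) < n := by exact_mod_cast hn
    rw [sub_div, mul_div_assoc, Real.div_sqrt]
    ring
  refine le_antisymm (ge_of_tendsto (tendsto_upperTail_atTop.comp hlim) ?_) zero_le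
  filter_upwards [eventually_ne_atTop 0] with n hn using hle n hn

end Noise

/-! ### The distance of two random times -/

lemma absDiff_eq (a b : ℕ∞) : absDiff a b = ((a - b + (b - a) : ℕ∞) : ℝ≥0∞) := by
  simp [absDiff]

lemma absDiff_natCast_ne_top (a b : ℕ) : absDiff a b ≠ ∞ := by
  rw [absDiff_eq]
  exact ENat.toENNReal_ne_top.2 (ENat.natCast_ne_top (a - b + (b - a)))

lemma absDiff_le_natCast_iff {a b : ℕ∞} {r : ℕ} :
    absDiff a b ≤ r ↔ a ≤ b + r ∧ b ≤ a + r := by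
  rw [absDiff_eq, ← ENat.toENNReal_coe, ENat.toENNReal_le]
  cases a with
  | top => cases b with
    | top => simp
    | coe b =>
      have : ¬ ((⊤ : ℕ∞) ≤ (b : ℕ∞) + (r : ℕ∞)) := by
        rw [top_le_iff]; exact_mod_cast ENat.natCast_ne_top (b + r)
      simp [this]
  | coe a => cases b with
    | top =>
      have : ¬ ((⊤ : ℕ∞) ≤ (a : ℕ∞) + (r : ℕ∞)) := by
        rw [top_le_iff]; exact_mod_cast ENat.natCast_ne_top (a + r)
      simp [this]
    | coe b => norm_cast; omega

lemma absDiff_le_ofReal_iff {a b : ℕ∞} {t : ℝ} (ht : 0 ≤ t) :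
    absDiff a b ≤ ENNReal.ofReal t ↔ absDiff a b ≤ (⌊t⌋₊ : ℕ) := by
  rw [absDiff_eq]
  generalize a - b + (b - a) = e
  cases e with
  | top => simp
  | coe e =>
    rw [ENat.toENNReal_coe, ← ENNReal.ofReal_natCast, ENNReal.ofReal_le_ofReal_iff ht]
    simp [Nat.le_floor_iff ht]

/-! ### Lower bound: no rule comes close to the passage time with larger probability -/

section Lower

variable {Ω : Type*} [MeasurableSpace Ω] {P : Measure Ω} {V : ℕ → Ω → ℝ} {s ℓ : ℝ}

lemma observationFiltration_le_past (hV : ∀ i, Measurable (V i)) (d t : ℕ) :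
    observationFiltration hV s d t ≤ past V (t - d) := by
  refine iSup₂_le fun j hj => Measurable.comap_le ?_
  unfold delayed
  split_ifs with h
  · exact measurable_const
  · exact measurable_walk_past_of_le (Nat.sub_le_sub_right hj d)

variable [IsProbabilityMeasure P]

/-- Passing a level `ℓ ≥ s d` much earlier than at time `d` is unlikely. -/
lemma IsStandardNoise.measure_early_le (hN : IsStandardNoise P V) (hs : 0 < s) {d D : ℕ}
    (hℓ : s * d ≤ ℓ) (hD : D ≠ 0) (hDd : D ≤ d) {A : Set Ω} (hA : MeasurableSet[past V 0] A) :
    P (A ∩ {ω | passageTime V s ℓ ω ≤ D}) ≤ P A * (2 * upperTail (s * (d - D) / √d)) := by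
  have h1 := hN.measure_passageTime_le_mul hs.le (B := A) (t := D) (ℓ := ℓ)
    (fun j _ => (past_mono (Nat.zero_le j) _ hA).inter (measurableSet_passageTime_eq j)) 0
  rw [Nat.cast_zero, Real.sqrt_zero, mul_zero, neg_zero, upperTail_zero, ← div_eq_mul_inv,
    ENNReal.div_le_iff (by simp) (by simp), add_zero] at h1
  have h2 : A ∩ {ω | ℓ ≤ walk V s D ω} ⊆
      A ∩ {ω | increment V 0 D ω ∈ Set.Ici (s * (d - D))} := by
    rintro ω ⟨hω, hle⟩
    have := walk_add (V := V) (s := s) 0 D ω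
    rw [zero_add, walk_zero] at this
    refine ⟨hω, ?_⟩
    simp only [Set.mem_ofPred_eq, Set.mem_Ici] at hle ⊢
    linarith
  have hDd' : (D : ℝ) ≤ d := by exact_mod_cast hDd
  calc _ ≤ P (A ∩ {ω | increment V 0 D ω ∈ Set.Ici (s * (d - D))}) * 2 := by
        refine h1.trans ?_
        gcongr
    _ = P A * (2 * upperTail (s * (d - D) / √D)) := by
        rw [hN.measure_inter_increment D hA measurableSet_Ici, gaussianReal_natCast_Ici hD]
        ring
    _ ≤ _ := by
        have hD0 : (0 : ℝ) < D := by exact_mod_cast Nat.pos_of_ne_zero hD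
        gcongr
        refine upperTail_anti ?_
        have : 0 ≤ s * ((d : ℝ) - D) := mul_nonneg hs.le (by linarith)
        gcongr

/-- Given the past up to time `k`, the passage falls into a given window of `n` steps which starts
`h` steps later with probability at most about `P(|N| ≤ s n / (2 √h))`: the position at the start
of the window is a Gaussian variable of variance `h`, and it has to lie in an interval whose length
is not much more than the drift `s n` over the window. -/
lemma IsStandardNoise.measure_window_le (hN : IsStandardNoise P V) (hs : 0 < s) {k h n : ℕ}
    (hh : h ≠ 0) (hn : n ≠ 0) (q : ℕ) (m : ℝ) {A : Set Ω} (hA : MeasurableSet[past V k] A) :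
    P (A ∩ {ω | ((k + h : ℕ) : WithTop ℕ) < passageTime V s ℓ ω ∧
        passageTime V s ℓ ω ≤ (k + h + n : ℕ)}) * upperTail (-(s * √q)) ≤
      P A * (centralMass ((s * (n + q) + m) / (2 * √h)) + upperTail (m / √(n + q : ℕ))) := by
  set t₀ := k + h with ht₀
  set w := s * (n + q) + m with hw
  have h1 := hN.measure_passageTime_le_mul hs.le (ℓ := ℓ) (t := t₀ + n)
    (B := A ∩ {ω | (t₀ : WithTop ℕ) < passageTime V s ℓ ω}) (fun j _ => by
      rcases le_or_gt j t₀ with hj | hj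
      · convert MeasurableSet.empty using 1
        ext ω
        simp only [Set.mem_inter_iff, Set.mem_ofPred_eq, Set.mem_empty_iff_false, iff_false]
        rintro ⟨⟨_, h1⟩, h2⟩
        rw [h2] at h1
        exact hj.not_gt (by exact_mod_cast h1)
      · convert (past_mono (show k ≤ j by omega) _ hA).inter
          (measurableSet_passageTime_eq (s := s) (ℓ := ℓ) j) using 1
        ext ω
        simp only [Set.mem_inter_iff, Set.mem_ofPred_eq]
        constructor
        · rintro ⟨⟨h1, _⟩, h2⟩
          exact ⟨h1, h2⟩
        · rintro ⟨h1, h2⟩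
          refine ⟨⟨h1, ?_⟩, h2⟩
          rw [h2]
          exact_mod_cast hj) q
  rw [Set.inter_assoc] at h1
  refine h1.trans ?_
  let S : Set (ℝ × ℝ) := {x | ℓ - w ≤ x.1 + s * h + x.2 ∧ x.1 + s * h + x.2 ≤ ℓ}
  have hf : Measurable fun x : ℝ × ℝ => x.1 + s * h + x.2 :=
    (measurable_fst.add_const _).add measurable_snd
  have hS : MeasurableSet S :=
    (measurableSet_le measurable_const hf).inter (measurableSet_le hf measurable_const)
  have hsub : (A ∩ {ω | (t₀ : WithTop ℕ) < passageTime V s ℓ ω}) ∩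
      {ω | ℓ ≤ walk V s (t₀ + n + q) ω} ⊆
      (A ∩ {ω | (walk V s k ω, increment V k h ω) ∈ S}) ∪
        (A ∩ {ω | increment V t₀ (n + q) ω ∈ Set.Ici m}) := by
    rintro ω ⟨⟨hω, h2⟩, h3⟩
    have h4 := walk_lt_of_lt_passageTime h2
    have h5 := walk_add (V := V) (s := s) k h ω
    have h6 := walk_add (V := V) (s := s) t₀ (n + q) ω
    rw [← ht₀] at h5
    rw [← add_assoc] at h6
    push_cast at h6
    simp only [Set.mem_ofPred_eq] at h3
    by_cases h7 : m ≤ increment V t₀ (n + q) ω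
    · exact Or.inr ⟨hω, h7⟩
    · refine Or.inl ⟨hω, ?_, ?_⟩ <;> simp only <;> linarith
  refine (measure_mono hsub).trans ((measure_union_le _ _).trans ?_)
  rw [mul_add]
  refine add_le_add (hN.measure_inter_past_le h hA (measurable_walk_past k) hS fun z => ?_) ?_
  · refine le_trans (measure_mono ?_) (gaussianReal_natCast_Icc_le hh (ℓ - w - z - s * h) w)
    rintro x ⟨h1, h2⟩
    simp only at h1 h2
    constructor <;> linarith
  · rw [hN.measure_inter_increment _ (past_mono (Nat.le_add_right k h) _ hA) measurableSet_Ici,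
      gaussianReal_natCast_Ici (by omega)]

/-- The bound of `measure_absDiff_le` on the probability that a rule which sees the walk with
delay `d` is within `r` steps of the passage time. The remaining parameters are free. -/
noncomputable def closeBound (s : ℝ) (d r q g : ℕ) (m : ℝ) : ℝ≥0∞ :=
  (centralMass ((s * ((2 * r + 1 : ℕ) + q) + m) / (2 * √(d - g - r - 1 : ℕ))) +
    upperTail (m / √(2 * r + 1 + q : ℕ))) / upperTail (-(s * √q)) +
    2 * upperTail (s * (g - r) / √d)

/-- No stopping time of the delayed observations is within `r` steps of the passage time with
probability larger than about `P(|N| ≤ s r / √d)`. Its value `c` is decided on the past up to time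
`c - d`, so `d` unobserved steps separate the decision from time `c`; a value `c` much below `d`
is no better, as the level is at least `s d`. -/
lemma IsStandardNoise.measure_absDiff_le (hN : IsStandardNoise P V) (hs : 0 < s) {d r q g : ℕ}
    {m : ℝ} (hm : 0 ≤ m) (hℓ : s * d ≤ ℓ) (hrg : r ≤ g) (hd : g + r + 1 < d) {η : Ω → WithTop ℕ}
    (hη : IsStoppingTime (observationFiltration hN.measurable s d) η) :
    P {ω | absDiff (η ω) (passageTime V s ℓ ω) ≤ r} ≤ closeBound s d r q g m := by
  have hηpast : ∀ c : ℕ, MeasurableSet[past V (c - d)] {ω | η ω = c} := fun c =>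
    observationFiltration_le_past hN.measurable d c _ (hη.measurableSet_eq c)
  have hpos : upperTail (-(s * √q)) ≠ 0 := upperTail_neg_ne_zero (by positivity)
  refine measure_le_of_forall_time_eq (fun c => hN.past_le _ _ (hηpast c)) ?_ fun c => ?_
  · refine measure_mono_null ?_ (hN.measure_passageTime_eq_top (ℓ := ℓ) hs)
    rintro ω ⟨h1, h2⟩
    have h3 := (absDiff_le_natCast_iff.1 h1).1
    rw [show η ω = ⊤ from h2] at h3
    by_contra h4
    obtain ⟨j, hj⟩ := WithTop.ne_top_iff_exists.1 h4
    rw [← hj] at h3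
    have h5 : (⊤ : ℕ∞) ≤ ((j + r : ℕ) : ℕ∞) := h3
    exact absurd (top_le_iff.1 h5) (ENat.natCast_ne_top _)
  · have hev : ∀ ω ∈ {ω | η ω = c} ∩ {ω | absDiff (η ω) (passageTime V s ℓ ω) ≤ r},
        η ω = c ∧ (c : WithTop ℕ) ≤ passageTime V s ℓ ω + (r : WithTop ℕ) ∧
          passageTime V s ℓ ω ≤ (c : WithTop ℕ) + (r : WithTop ℕ) := by
      rintro ω ⟨h1, h2⟩
      have h3 := absDiff_le_natCast_iff.1 h2
      rw [show η ω = c from h1] at h3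
      exact ⟨h1, h3⟩
    rcases le_or_gt (c + g) d with hc | hc
    · have hA : MeasurableSet[past V 0] {ω | η ω = c} := by
        have := hηpast c
        rwa [Nat.sub_eq_zero_of_le (by omega)] at this
      have h1 := hN.measure_early_le hs (d := d) (D := d - g + r) hℓ (by omega) (by omega) hA
      refine (measure_mono ?_).trans (h1.trans ?_)
      · intro ω hω
        obtain ⟨h2, -, h3⟩ := hev ω hω
        refine ⟨h2, h3.trans ?_⟩
        exact (Nat.cast_le (α := ℕ∞)).2 (by omega : c + r ≤ d - g + r)
      · unfold closeBound
        have : (d : ℝ) - (d - g + r : ℕ) = g - r := by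
          rw [Nat.cast_add, Nat.cast_sub (by omega)]
          ring
        rw [this]
        gcongr
        exact le_add_self
    · obtain ⟨h, hh⟩ : ∃ h, c - d + h + (r + 1) = c := ⟨c - (r + 1) - (c - d), by omega⟩
      have h1 := hN.measure_window_le hs (ℓ := ℓ) (k := c - d) (h := h) (n := 2 * r + 1)
        (by omega) (by omega) q m (hηpast c)
      rw [← ENNReal.le_div_iff_mul_le (Or.inl hpos) (Or.inl (upperTail_ne_top _))] at h1
      refine (measure_mono ?_).trans (h1.trans ?_)
      · intro ω hω
        obtain ⟨h2, h3, h4⟩ := hev ω hω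
        refine ⟨h2, ?_, ?_⟩
        · by_contra! h5
          have h6 : (c : WithTop ℕ) ≤ ((c - d + h : ℕ) : WithTop ℕ) + (r : WithTop ℕ) :=
            h3.trans (by gcongr)
          have h7 : c ≤ c - d + h + r := by exact_mod_cast h6
          omega
        · refine h4.trans ?_
          exact (Nat.cast_le (α := ℕ∞)).2 (by omega : c + r ≤ c - d + h + (2 * r + 1))
      · rw [mul_div_assoc]
        unfold closeBound
        gcongr
        refine le_add_right ?_
        gcongr
        · refine centralMass_mono ?_
          have : (0 : ℝ) < (d - g - r - 1 : ℕ) := by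
            exact_mod_cast (by omega : 0 < d - g - r - 1)
          gcongr
          omega

end Lower

/-! ### Scales between `1` and `d` -/

/-- The scale `d ^ (1 / 8)`, of which the free parameters of the bounds are powers: `√d` is its
fourth power. -/
noncomputable def scale (d : ℕ) : ℝ := (d : ℝ) ^ (1 / 8 : ℝ)

lemma scale_pow_eight (d : ℕ) : scale d ^ 8 = d := by
  rw [scale, ← Real.rpow_natCast, ← Real.rpow_mul d.cast_nonneg]
  norm_num

lemma scale_nonneg (d : ℕ) : 0 ≤ scale d := Real.rpow_nonneg d.cast_nonneg _

lemma sqrt_eq_scale_pow (d : ℕ) : √(d : ℝ) = scale d ^ 4 := by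
  rw [Real.sqrt_eq_iff_mul_self_eq d.cast_nonneg (pow_nonneg (scale_nonneg d) 4),
    ← scale_pow_eight]
  ring

lemma tendsto_scale : Tendsto scale atTop atTop :=
  (tendsto_rpow_atTop (by norm_num)).comp tendsto_natCast_atTop_atTop

lemma tendsto_scale_pow {n : ℕ} (hn : n ≠ 0) : Tendsto (fun d => scale d ^ n) atTop atTop :=
  (tendsto_pow_atTop hn).comp tendsto_scale

lemma tendsto_inv_scale_pow {n : ℕ} (hn : n ≠ 0) :
    Tendsto (fun d => (scale d ^ n)⁻¹) atTop (𝓝 0) :=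
  tendsto_inv_atTop_zero.comp (tendsto_scale_pow hn)

lemma tendsto_floor_scale_pow {n : ℕ} (hn : n ≠ 0) :
    Tendsto (fun d => (⌊scale d ^ n⌋₊ : ℝ) / scale d ^ n) atTop (𝓝 1) :=
  tendsto_nat_floor_div_atTop.comp (tendsto_scale_pow hn)

lemma tendsto_floor_mul_sqrt {x : ℝ} (hx : 0 ≤ x) :
    Tendsto (fun d : ℕ => (⌊x * √d⌋₊ : ℝ) / scale d ^ 4) atTop (𝓝 x) := by
  simp_rw [sqrt_eq_scale_pow]
  exact (tendsto_nat_floor_mul_div_atTop hx).comp (tendsto_scale_pow four_ne_zero)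

/-- A quantity of order `√d` is negligible against `d`. -/
lemma tendsto_div_scale_pow_eight {f : ℕ → ℝ} {c : ℝ}
    (hf : Tendsto (fun d => f d / scale d ^ 4) atTop (𝓝 c)) :
    Tendsto (fun d => f d / scale d ^ 8) atTop (𝓝 0) := by
  have h := hf.mul (tendsto_inv_scale_pow four_ne_zero)
  rw [mul_zero] at h
  refine h.congr fun d => ?_
  rw [← div_eq_mul_inv, div_div, ← pow_add]

lemma tendsto_floor_scale_sq_div :
    Tendsto (fun d => (⌊scale d ^ 2⌋₊ : ℝ) / scale d ^ 4) atTop (𝓝 0) := by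
  have h := (tendsto_floor_scale_pow two_ne_zero).mul (tendsto_inv_scale_pow two_ne_zero)
  rw [mul_zero] at h
  refine h.congr fun d => ?_
  rw [← div_eq_mul_inv, div_div, ← pow_add]

lemma tendsto_scale_pow_div {m n : ℕ} (h : m < n) :
    Tendsto (fun d => scale d ^ m / scale d ^ n) atTop (𝓝 0) := by
  refine (tendsto_inv_scale_pow (Nat.sub_ne_zero_of_lt h)).congr' ?_
  filter_upwards [tendsto_scale.eventually_gt_atTop 0] with d hd
  obtain ⟨k, rfl⟩ := Nat.exists_eq_add_of_lt h
  rw [show m + k + 1 - m = k + 1 by omega, add_assoc, pow_add (scale d) m,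
    div_mul_cancel_left₀ (by positivity)]

lemma tendsto_upperTail_neg_sqrt_floor {s : ℝ} (hs : 0 < s) :
    Tendsto (fun d => upperTail (-(s * √(⌊scale d ^ 2⌋₊ : ℕ)))) atTop (𝓝 1) :=
  tendsto_upperTail_atBot.comp <| tendsto_neg_atTop_atBot.comp <|
    (Real.tendsto_sqrt_atTop.comp <| tendsto_natCast_atTop_atTop.comp <|
      tendsto_nat_floor_atTop.comp <| tendsto_scale_pow two_ne_zero).const_mul_atTop hs

/-- The bound on the probability that a rule is within `x √d` steps of the passage time, at the
choice of parameters for which it converges. -/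
noncomputable def closeLimitBound (s x : ℝ) (d : ℕ) : ℝ≥0∞ :=
  closeBound s d ⌊x * √d⌋₊ ⌊scale d ^ 2⌋₊ ⌊scale d ^ 6⌋₊ (scale d ^ 3)

lemma eventually_floor_add_lt {x : ℝ} (hx : 0 ≤ x) :
    ∀ᶠ d : ℕ in atTop, ⌊scale d ^ 6⌋₊ + ⌊x * √d⌋₊ + 1 < d := by
  have h1 := ((tendsto_floor_scale_pow (by norm_num : 6 ≠ 0)).mul
    (tendsto_inv_scale_pow two_ne_zero)).add
      ((tendsto_div_scale_pow_eight (tendsto_floor_mul_sqrt hx)).add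
        (tendsto_inv_scale_pow (by norm_num : 8 ≠ 0)))
  simp only [mul_zero, add_zero] at h1
  filter_upwards [h1.eventually (gt_mem_nhds one_pos), tendsto_scale.eventually_gt_atTop 0]
    with d hd hpos
  rw [← div_eq_mul_inv, div_div, ← pow_add, inv_eq_one_div, ← add_div, ← add_div,
    div_lt_one (by positivity), scale_pow_eight, ← add_assoc] at hd
  exact_mod_cast hd

lemma eventually_floor_le (x : ℝ) :
    ∀ᶠ d : ℕ in atTop, ⌊x * √d⌋₊ ≤ ⌊scale d ^ 6⌋₊ := by
  filter_upwards [(tendsto_scale_pow two_ne_zero).eventually_ge_atTop x] with d hd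
  refine Nat.floor_mono ?_
  rw [sqrt_eq_scale_pow]
  calc x * scale d ^ 4 ≤ scale d ^ 2 * scale d ^ 4 := by
        have := scale_nonneg d
        gcongr
    _ = scale d ^ 6 := by ring

lemma tendsto_closeLimitBound {s x : ℝ} (hs : 0 < s) (hx : 0 < x) :
    Tendsto (closeLimitBound s x) atTop (𝓝 (centralMass (s * x))) := by
  have hr := tendsto_floor_mul_sqrt hx.le
  have hq := tendsto_floor_scale_sq_div
  have h1 := tendsto_inv_scale_pow four_ne_zero
  have hpos := tendsto_scale.eventually_gt_atTop 0
  have hwin : Tendsto (fun d : ℕ => ((2 * ⌊x * √d⌋₊ + 1 : ℕ) + ⌊scale d ^ 2⌋₊ : ℝ) / scale d ^ 4)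
      atTop (𝓝 (2 * x)) := by
    have h := ((hr.const_mul 2).add h1).add hq
    simp only [add_zero] at h
    refine h.congr fun d => ?_
    push_cast
    ring
  have hvar : Tendsto (fun d : ℕ => √(d - ⌊scale d ^ 6⌋₊ - ⌊x * √d⌋₊ - 1 : ℕ) / scale d ^ 4)
      atTop (𝓝 1) := by
    have h := (((tendsto_const_nhds (x := (1 : ℝ))).sub ((tendsto_floor_scale_pow
      (by norm_num : 6 ≠ 0)).mul (tendsto_inv_scale_pow two_ne_zero))).sub
      (tendsto_div_scale_pow_eight hr)).sub (tendsto_inv_scale_pow (by norm_num : 8 ≠ 0))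
    simp only [mul_zero, sub_zero] at h
    have h' := h.sqrt
    rw [Real.sqrt_one] at h'
    refine h'.congr' ?_
    filter_upwards [eventually_floor_add_lt hx.le, hpos] with d hd hd0
    rw [Nat.cast_sub (by omega), Nat.cast_sub (by omega), Nat.cast_sub (by omega),
      ← scale_pow_eight d]
    rw [← Real.sqrt_sq (by positivity : 0 ≤ scale d ^ 4), ← Real.sqrt_div' _ (by positivity)]
    congr 1
    field_simp
    push_cast
    ring
  have hcentral : Tendsto (fun d : ℕ => centralMass
      ((s * ((2 * ⌊x * √d⌋₊ + 1 : ℕ) + ⌊scale d ^ 2⌋₊) + scale d ^ 3) /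
        (2 * √(d - ⌊scale d ^ 6⌋₊ - ⌊x * √d⌋₊ - 1 : ℕ)))) atTop (𝓝 (centralMass (s * x))) := by
    refine tendsto_centralMass (by positivity) ?_
    have h := ((hwin.const_mul s).add (tendsto_scale_pow_div (by norm_num : 3 < 4))).div
      (hvar.const_mul 2) (by norm_num)
    rw [show (s * (2 * x) + 0) / (2 * 1) = s * x by ring] at h
    refine h.congr' ?_
    filter_upwards [hpos] with d hd
    rw [Pi.div_apply, mul_div_assoc', ← add_div, mul_div_assoc',
      div_div_div_cancel_right₀ (by positivity)]
  have hfluct : Tendsto (fun d : ℕ => upperTail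
      (scale d ^ 3 / √(2 * ⌊x * √d⌋₊ + 1 + ⌊scale d ^ 2⌋₊ : ℕ))) atTop (𝓝 0) := by
    refine tendsto_upperTail_atTop.comp ?_
    have h := tendsto_scale.atTop_mul_pos (C := (√(2 * x))⁻¹) (by positivity)
      (hwin.sqrt.inv₀ (by positivity))
    refine h.congr' ?_
    filter_upwards [hpos] with d hd
    have e : √(scale d ^ 4) = scale d ^ 2 := by
      rw [show scale d ^ 4 = (scale d ^ 2) ^ 2 by ring, Real.sqrt_sq (by positivity)]
    rw [Real.sqrt_div' _ (by positivity), e, inv_div, ← mul_div_assoc]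
    push_cast
    congr 1
    ring
  have hearly : Tendsto (fun d : ℕ => upperTail
      (s * ((⌊scale d ^ 6⌋₊ : ℕ) - (⌊x * √d⌋₊ : ℕ)) / √d)) atTop (𝓝 0) := by
    refine tendsto_upperTail_atTop.comp ?_
    have h := (((tendsto_scale_pow two_ne_zero).atTop_mul_pos one_pos (tendsto_floor_scale_pow
      (by norm_num : 6 ≠ 0))).atTop_add hr.neg).const_mul_atTop hs
    refine h.congr' ?_
    filter_upwards [hpos] with d hd
    rw [sqrt_eq_scale_pow]
    field_simp
    ring
  have h := (ENNReal.Tendsto.div (hcentral.add hfluct) (Or.inr one_ne_zero)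
    (tendsto_upperTail_neg_sqrt_floor hs) (Or.inl ENNReal.one_ne_top)).add
      (ENNReal.Tendsto.const_mul hearly (Or.inr ENNReal.ofNat_ne_top) (a := 2))
  rw [show centralMass (s * x) = (centralMass (s * x) + 0) / 1 + 2 * 0 by simp]
  exact h

/-- Uniformly over all thresholds `ℓ ≥ s d` and all rules, the probability of being within `x √d`
steps of the passage time is at most `P(|N| ≤ s x)` in the limit. -/
lemma IsStandardNoise.eventually_measure_absDiff_le {Ω : Type*} [MeasurableSpace Ω]
    {P : Measure Ω} [IsProbabilityMeasure P] {V : ℕ → Ω → ℝ} (hN : IsStandardNoise P V) {s x : ℝ}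
    (hs : 0 < s) (hx : 0 ≤ x) :
    ∀ᶠ d : ℕ in atTop, ∀ ℓ : ℝ, s * d ≤ ℓ → ∀ η : Ω → WithTop ℕ,
      IsStoppingTime (observationFiltration hN.measurable s d) η →
      P {ω | absDiff (η ω) (passageTime V s ℓ ω) ≤ ENNReal.ofReal (x * √d)} ≤
        closeLimitBound s x d := by
  filter_upwards [eventually_floor_add_lt hx, eventually_floor_le x] with d h1 h2 ℓ hℓ η hη
  have e : {ω | absDiff (η ω) (passageTime V s ℓ ω) ≤ ENNReal.ofReal (x * √d)} =
      {ω | absDiff (η ω) (passageTime V s ℓ ω) ≤ (⌊x * √d⌋₊ : ℕ)} :=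
    Set.ext fun ω => absDiff_le_ofReal_iff (mul_nonneg hx (Real.sqrt_nonneg d))
  rw [e]
  exact hN.measure_absDiff_le hs (pow_nonneg (scale_nonneg d) 3) hℓ h2 h1 hη

/-! ### Upper bound: the delayed rule -/

section Upper

variable {Ω : Type*} {V : ℕ → Ω → ℝ} {s ℓ : ℝ}

lemma passageTime_mono {a b : ℝ} (h : a ≤ b) (ω : Ω) :
    passageTime V s a ω ≤ passageTime V s b ω :=
  hittingAfter_anti _ _ (Set.Ici_subset_Ici.2 h) ω

lemma delayedRuleFrom_le_iff {m d t : ℕ} {ω : Ω} :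
    delayedRuleFrom m V s ℓ d ω ≤ t ↔ ∃ j, m ≤ j ∧ j ≤ t ∧ ℓ - s * d ≤ delayed V s d j ω := by
  change hittingAfter (delayed V s d) (Set.Ici (ℓ - s * d)) m ω ≤ WithTop.some t ↔ _
  rw [hittingAfter_le_iff]
  simp [and_assoc]

lemma delayed_add (d j : ℕ) (ω : Ω) : delayed V s d (j + d) ω = walk V s j ω := by
  unfold delayed
  split_ifs with h
  · rw [Nat.le_zero.1 (by omega : j ≤ 0), walk_zero]
  · rw [Nat.add_sub_cancel]

/-- The rule which waits for the delayed observation to reach `ℓ - s d` stops `d` steps after the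
walk has passed that level. -/
lemma delayedRuleFrom_eq (d : ℕ) (ω : Ω) :
    delayedRuleFrom d V s ℓ d ω = passageTime V s (ℓ - s * d) ω + (d : WithTop ℕ) := by
  refine eq_of_forall_ge_iff fun c => ?_
  cases c with
  | top => simp
  | coe t =>
    refine delayedRuleFrom_le_iff.trans ⟨?_, fun h => ?_⟩
    · rintro ⟨j, hj, hjt, hle⟩
      obtain ⟨i, rfl⟩ := Nat.exists_eq_add_of_le' hj
      rw [delayed_add] at hle
      calc passageTime V s (ℓ - s * d) ω + (d : WithTop ℕ)
          ≤ (i : WithTop ℕ) + (d : WithTop ℕ) := by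
            gcongr
            exact passageTime_le_iff.2 ⟨i, le_rfl, hle⟩
        _ ≤ _ := WithTop.coe_le_coe.2 hjt
    · cases hσ : passageTime V s (ℓ - s * d) ω with
      | top => rw [hσ] at h; simp at h
      | coe k =>
        rw [hσ] at h
        have h' : k + d ≤ t := WithTop.coe_le_coe.1 h
        refine ⟨k + d, Nat.le_add_left d k, h', ?_⟩
        rw [delayed_add]
        exact le_walk_of_passageTime_eq hσ

/-- The observations before time `d` are all `0`, so they do not matter for a positive level. -/
lemma delayedRuleFrom_zero_eq {d : ℕ} (h : s * d < ℓ) :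
    delayedRuleFrom 0 V s ℓ d = delayedRuleFrom d V s ℓ d := by
  ext1 ω
  refine eq_of_forall_ge_iff fun c => ?_
  cases c with
  | top => simp
  | coe t =>
    refine delayedRuleFrom_le_iff.trans (Iff.trans ?_ delayedRuleFrom_le_iff.symm)
    refine exists_congr fun j => ⟨fun ⟨_, hj, hle⟩ => ⟨?_, hj, hle⟩,
      fun ⟨_, hj, hle⟩ => ⟨Nat.zero_le j, hj, hle⟩⟩
    by_contra! hjd
    rw [delayed, if_pos hjd.le] at hle
    linarith

variable [MeasurableSpace Ω] {P : Measure Ω}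

lemma isStoppingTime_delayedRuleFrom (hV : ∀ i, Measurable (V i)) (d : ℕ) :
    IsStoppingTime (observationFiltration hV s d) (delayedRuleFrom d V s ℓ d) :=
  Adapted.isStoppingTime_hittingAfter
    (fun t => (Filtration.stronglyAdapted_natural (stronglyMeasurable_delayed hV s d) t).measurable)
    measurableSet_Ici

variable [IsProbabilityMeasure P]

lemma IsStandardNoise.measure_inter_eq_top (hN : IsStandardNoise P V) (hs : 0 < s) (E : Set Ω) :
    P (E ∩ {ω | passageTime V s ℓ ω = ⊤}) = 0 :=
  measure_mono_null Set.inter_subset_right (hN.measure_passageTime_eq_top hs)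

/-- The walk is at least at `ℓ - s d` when the delayed rule is triggered, so that a passage later
than `n` steps after the rule needs a Gaussian increment over `d + n` steps below `-s n`. -/
lemma IsStandardNoise.measure_late_le (hN : IsStandardNoise P V) (hs : 0 < s) {d : ℕ}
    (hd : d ≠ 0) (n : ℕ) :
    P {ω | ¬ passageTime V s ℓ ω ≤
        passageTime V s (ℓ - s * d) ω + (d : WithTop ℕ) + (n : WithTop ℕ)} ≤
      upperTail (s * n / √(d + n : ℕ)) := by
  refine measure_le_of_forall_time_eq (η := passageTime V s (ℓ - s * d))
    (fun k => hN.measurableSet_eq k) (hN.measure_inter_eq_top hs _) fun k => ?_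
  rw [← gaussianReal_natCast_Iic (by omega),
    ← hN.measure_inter_increment (d + n) (measurableSet_passageTime_eq k) measurableSet_Iic]
  refine measure_mono ?_
  rintro ω ⟨h1, h2⟩
  refine ⟨h1, ?_⟩
  have h3 := le_walk_of_passageTime_eq h1
  rw [Set.mem_ofPred_eq, show passageTime V s (ℓ - s * d) ω = k from h1, not_le] at h2
  have h4 : walk V s (k + (d + n)) ω < ℓ := by
    refine walk_lt_of_lt_passageTime (lt_of_eq_of_lt ?_ h2)
    rw [← add_assoc]
    push_cast
    rfl
  rw [walk_add] at h4
  push_cast at h4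
  simp only [Set.mem_ofPred_eq, Set.mem_Iic]
  linarith

/-- A passage more than `r` steps before the delayed rule needs a large overshoot over `ℓ - s d` or
a Gaussian increment over about `d - r` steps which exceeds about `s r`. -/
lemma IsStandardNoise.measure_premature_le (hN : IsStandardNoise P V) (hs : 0 < s) {d q : ℕ}
    {ρ : ℝ} (hℓ : s * d ≤ ℓ) (hq : q ≠ 0) (hρ : 0 ≤ ρ) (r : ℕ) :
    P {ω | ¬ passageTime V s (ℓ - s * d) ω + (d : WithTop ℕ) ≤
        passageTime V s ℓ ω + (r : WithTop ℕ)} ≤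
      (ENNReal.ofReal (Real.exp (-ρ ^ 2 / 2)) +
        upperTail ((s * (r - q) - ρ) / √(d - (r + 1) + q : ℕ))) / upperTail (-(s * √q)) := by
  set a := ℓ - s * d with ha
  have hσ : ∀ ω, passageTime V s a ω ≤ passageTime V s ℓ ω :=
    passageTime_mono (by have : 0 ≤ s * d := by positivity
                         linarith)
  have hpos : upperTail (-(s * √q)) ≠ 0 := upperTail_neg_ne_zero (by positivity)
  refine measure_le_of_forall_time_eq (η := passageTime V s a)
    (fun k => hN.measurableSet_eq k) (hN.measure_inter_eq_top hs _) fun k => ?_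
  set B := {ω | passageTime V s a ω = k} with hB
  have hBk : MeasurableSet[past V k] B := measurableSet_passageTime_eq k
  -- The passage of `ℓ` at time `j` comes after that of `a`, so `r < d`.
  have hev : ∀ ω ∈ B ∩ {ω | ¬ passageTime V s a ω + (d : WithTop ℕ) ≤
      passageTime V s ℓ ω + (r : WithTop ℕ)},
      r < d ∧ passageTime V s ℓ ω ≤ (k + (d - (r + 1)) : ℕ) := by
    rintro ω ⟨h1, h2⟩
    have h1' : passageTime V s a ω = k := h1
    have h3 := hσ ω
    rw [Set.mem_ofPred_eq, h1', not_le] at h2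
    rw [h1'] at h3
    cases hj : passageTime V s ℓ ω with
    | top => rw [hj] at h2; simp at h2
    | coe j =>
      rw [hj] at h2 h3
      have h2' : j + r < k + d := WithTop.coe_lt_coe.1 h2
      have h3' : k ≤ j := WithTop.coe_le_coe.1 h3
      exact ⟨by omega, WithTop.coe_le_coe.2 (by simp only [Nat.cast_id]; omega)⟩
  by_cases hrd : r < d
  swap
  · refine (measure_mono_null (fun ω hω => hrd (hev ω hω).1) measure_empty).trans_le zero_le
  set D := d - (r + 1) with hD
  have h1 := hN.measure_passageTime_le_mul hs.le (ℓ := ℓ) (B := B) (t := k + D) (fun j _ => by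
    rcases lt_or_ge j k with hj | hj
    · convert MeasurableSet.empty using 1
      ext ω
      simp only [hB, Set.mem_inter_iff, Set.mem_ofPred_eq, Set.mem_empty_iff_false, iff_false]
      rintro ⟨h1, h2⟩
      have h3 := hσ ω
      rw [h1, h2] at h3
      exact hj.not_ge (by exact_mod_cast h3)
    · exact (past_mono hj _ hBk).inter (measurableSet_passageTime_eq j)) q
  rw [← mul_div_assoc, ENNReal.le_div_iff_mul_le (Or.inl hpos) (Or.inl (upperTail_ne_top _))]
  have hsub₀ : B ∩ {ω | ¬ passageTime V s a ω + (d : WithTop ℕ) ≤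
      passageTime V s ℓ ω + (r : WithTop ℕ)} ⊆ B ∩ {ω | passageTime V s ℓ ω ≤ (k + D : ℕ)} :=
    fun ω hω => ⟨hω.1, (hev ω hω).2⟩
  refine le_trans (mul_le_mul_left (measure_mono hsub₀) _) (h1.trans ?_)
  have hsub : B ∩ {ω | ℓ ≤ walk V s (k + D + q) ω} ⊆ (B ∩ {ω | a + ρ + s ≤ walk V s k ω}) ∪
      (B ∩ {ω | increment V k (D + q) ω ∈ Set.Ici (s * (r - q) - ρ)}) := by
    rintro ω ⟨hω, h2⟩
    by_cases h3 : a + ρ + s ≤ walk V s k ω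
    · exact Or.inl ⟨hω, h3⟩
    · refine Or.inr ⟨hω, ?_⟩
      have h4 := walk_add (V := V) (s := s) k (D + q) ω
      rw [← add_assoc, hD] at h4
      push_cast [Nat.cast_sub (by omega : r + 1 ≤ d)] at h4
      simp only [Set.mem_ofPred_eq, Set.mem_Ici, hD] at h2 ⊢
      rw [not_le] at h3
      linarith
  refine (measure_mono hsub).trans ((measure_union_le _ _).trans ?_)
  rw [mul_add]
  refine add_le_add (hN.measure_overshoot_le hs (by linarith) hρ k) ?_
  rw [hN.measure_inter_increment _ hBk measurableSet_Ici, gaussianReal_natCast_Ici (by omega)]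

/-- The bound of `measure_lt_absDiff_rule_le` on the probability that the delayed rule misses the
passage time by more than `r` steps. The parameters `q` and `ρ` are free. -/
noncomputable def farBound (s : ℝ) (d r q : ℕ) (ρ : ℝ) : ℝ≥0∞ :=
  upperTail (s * r / √(d + r : ℕ)) +
    (ENNReal.ofReal (Real.exp (-ρ ^ 2 / 2)) +
      upperTail ((s * (r - q) - ρ) / √(d - (r + 1) + q : ℕ))) / upperTail (-(s * √q))

lemma IsStandardNoise.measure_lt_absDiff_rule_le (hN : IsStandardNoise P V) (hs : 0 < s)
    {d q r : ℕ} {ρ : ℝ} (hℓ : s * d ≤ ℓ) (hd : d ≠ 0) (hq : q ≠ 0) (hρ : 0 ≤ ρ) :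
    P {ω | ¬ absDiff (delayedRuleFrom d V s ℓ d ω) (passageTime V s ℓ ω) ≤ r} ≤
      farBound s d r q ρ := by
  refine le_trans (measure_mono ?_) ((measure_union_le _ _).trans
    (add_le_add (hN.measure_late_le (ℓ := ℓ) hs hd r) (hN.measure_premature_le hs hℓ hq hρ r)))
  intro ω hω
  have h := mt absDiff_le_natCast_iff.2 hω
  rw [not_and_or, delayedRuleFrom_eq] at h
  exact h.symm

/-- The bound on the probability that the delayed rule misses the passage time by more than
`x √d` steps, at the choice of parameters for which it converges. -/
noncomputable def farLimitBound (s x : ℝ) (d : ℕ) : ℝ≥0∞ :=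
  farBound s d ⌊x * √d⌋₊ ⌊scale d ^ 2⌋₊ (scale d)

lemma tendsto_farLimitBound {x : ℝ} (hs : 0 < s) (hx : 0 < x) :
    Tendsto (farLimitBound s x) atTop (𝓝 (2 * upperTail (s * x))) := by
  have hr := tendsto_floor_mul_sqrt hx.le
  have hq := tendsto_floor_scale_sq_div
  have hpos := tendsto_scale.eventually_gt_atTop 0
  have hroot : ∀ d, √(scale d ^ 8) = scale d ^ 4 := fun d => by
    rw [show scale d ^ 8 = (scale d ^ 4) ^ 2 by ring,
      Real.sqrt_sq (pow_nonneg (scale_nonneg d) 4)]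
  have hlate : Tendsto (fun d : ℕ => upperTail (s * (⌊x * √d⌋₊ : ℕ) / √(d + ⌊x * √d⌋₊ : ℕ)))
      atTop (𝓝 (upperTail (s * x))) := by
    refine (continuous_upperTail.tendsto _).comp ?_
    have h := (hr.const_mul s).div ((tendsto_const_nhds (x := (1 : ℝ))).add
      (tendsto_div_scale_pow_eight hr)).sqrt (by norm_num)
    rw [add_zero, Real.sqrt_one, div_one] at h
    refine h.congr' ?_
    filter_upwards [hpos] with d hd
    have e : (1 : ℝ) + ⌊x * √d⌋₊ / scale d ^ 8 = (d + ⌊x * √d⌋₊ : ℕ) / scale d ^ 8 := by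
      push_cast
      rw [add_div, ← scale_pow_eight d, div_self (by positivity)]
    rw [Pi.div_apply, e, Real.sqrt_div' _ (by positivity), hroot, mul_div_assoc',
      div_div_div_cancel_right₀ (by positivity)]
  have hover : Tendsto (fun d => ENNReal.ofReal (Real.exp (-scale d ^ 2 / 2))) atTop (𝓝 0) := by
    rw [← ENNReal.ofReal_zero]
    refine ENNReal.tendsto_ofReal (Real.tendsto_exp_atBot.comp ?_)
    simp_rw [neg_div]
    exact tendsto_neg_atTop_atBot.comp ((tendsto_scale_pow two_ne_zero).atTop_div_const two_pos)
  have hprem : Tendsto (fun d : ℕ => upperTail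
      ((s * ((⌊x * √d⌋₊ : ℕ) - (⌊scale d ^ 2⌋₊ : ℕ)) - scale d) /
        √(d - (⌊x * √d⌋₊ + 1) + ⌊scale d ^ 2⌋₊ : ℕ))) atTop (𝓝 (upperTail (s * x))) := by
    refine (continuous_upperTail.tendsto _).comp ?_
    have hvar := (((tendsto_const_nhds (x := (1 : ℝ))).sub ((tendsto_div_scale_pow_eight hr).add
      (tendsto_inv_scale_pow (by norm_num : 8 ≠ 0)))).add (tendsto_div_scale_pow_eight hq)).sqrt
    have h := (((hr.sub hq).const_mul s).sub (tendsto_scale_pow_div (by norm_num : 1 < 4))).div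
      hvar (by norm_num)
    simp only [add_zero, sub_zero, Real.sqrt_one, div_one] at h
    refine h.congr' ?_
    filter_upwards [hpos, eventually_floor_add_lt hx.le] with d hd hlt
    have e : (1 : ℝ) - (⌊x * √d⌋₊ / scale d ^ 8 + (scale d ^ 8)⁻¹) +
        ⌊scale d ^ 2⌋₊ / scale d ^ 8 =
        (d - (⌊x * √d⌋₊ + 1) + ⌊scale d ^ 2⌋₊ : ℕ) / scale d ^ 8 := by
      rw [Nat.cast_add, Nat.cast_sub (by omega), ← scale_pow_eight d]
      push_cast
      field_simp
    rw [Pi.div_apply, e, Real.sqrt_div' _ (by positivity), hroot, ← sub_div, mul_div_assoc',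
      pow_one, ← sub_div, div_div_div_cancel_right₀ (by positivity)]
  have h := hlate.add (ENNReal.Tendsto.div (hover.add hprem) (Or.inr one_ne_zero)
    (tendsto_upperTail_neg_sqrt_floor hs) (Or.inl ENNReal.one_ne_top))
  rw [zero_add, div_one, ← two_mul] at h
  exact h

lemma IsStandardNoise.eventually_measure_rule_le (hN : IsStandardNoise P V) {x : ℝ}
    (hs : 0 < s) (hx : 0 ≤ x) :
    ∀ᶠ d : ℕ in atTop, ∀ ℓ : ℝ, s * d ≤ ℓ →
      P {ω | ENNReal.ofReal (x * √d) <
        absDiff (delayedRuleFrom d V s ℓ d ω) (passageTime V s ℓ ω)} ≤ farLimitBound s x d := by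
  filter_upwards [eventually_ne_atTop 0, (tendsto_nat_floor_atTop.comp
    (tendsto_scale_pow two_ne_zero)).eventually_ne_atTop 0] with d hd hq ℓ hℓ
  refine le_trans (measure_mono fun ω hω => ?_)
    (hN.measure_lt_absDiff_rule_le hs hℓ hd hq (scale_nonneg d))
  exact fun h => not_le.2 hω
    ((absDiff_le_ofReal_iff (mul_nonneg hx (Real.sqrt_nonneg d))).2 h)

/-- Exponential tails for the normalized error of the delayed rule, uniformly in `d` and `ℓ`. -/
lemma IsStandardNoise.measure_rule_le_exp (hN : IsStandardNoise P V) {x : ℝ}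
    (hs : 0 < s) (hx : 0 ≤ x) {d : ℕ} (hd : d ≠ 0) (hℓ : s * d ≤ ℓ) :
    P {ω | ENNReal.ofReal (x * √d) <
        absDiff (delayedRuleFrom d V s ℓ d ω) (passageTime V s ℓ ω)} ≤
      ENNReal.ofReal (5 * Real.exp (s ^ 2 / 2) * Real.exp (-(s ^ 2 / 8) * x)) := by
  rcases lt_or_ge x 4 with hx4 | hx4
  · refine prob_le_one.trans ?_
    rw [mul_assoc, ← Real.exp_add, ← ENNReal.ofReal_one]
    refine ENNReal.ofReal_le_ofReal ?_
    have : 1 ≤ Real.exp (s ^ 2 / 2 + -(s ^ 2 / 8) * x) :=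
      Real.one_le_exp (by nlinarith [sq_nonneg s])
    linarith
  set r := ⌊x * √d⌋₊ with hr
  have hd1 : (1 : ℝ) ≤ d := by exact_mod_cast Nat.one_le_iff_ne_zero.2 hd
  set y := √(d : ℝ) with hy
  have hy1 : 1 ≤ y := Real.one_le_sqrt.2 hd1
  have hyd : y ^ 2 = d := Real.sq_sqrt (by linarith)
  have hxy : 4 * y ≤ x * y := by gcongr
  have hr1 : x * y / 2 ≤ (r : ℝ) - 1 := by
    have := Nat.lt_floor_add_one (x * y)
    rw [← hr] at this
    linarith
  have hρ : 0 ≤ s * (r - 1) / 2 := by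
    have : (0 : ℝ) ≤ r - 1 := by linarith
    positivity
  refine (measure_mono fun ω hω => ?_).trans
    ((hN.measure_lt_absDiff_rule_le hs hℓ hd one_ne_zero hρ (r := r)).trans ?_)
  · exact fun h => not_le.2 hω ((absDiff_le_ofReal_iff (mul_nonneg hx (Real.sqrt_nonneg d))).2 h)
  -- All Gaussian tails in the bound are evaluated at points whose squares are at least `s² x / 4`.
  set b := ENNReal.ofReal (Real.exp (-(s ^ 2 / 8) * x)) with hb
  have htail : ∀ z : ℝ, s ^ 2 * x / 4 ≤ z ^ 2 →
      ENNReal.ofReal (Real.exp (-z ^ 2 / 2)) ≤ b := fun z hz =>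
    ENNReal.ofReal_le_ofReal (Real.exp_le_exp.2 (by linarith))
  have hs2 : 0 < s ^ 2 := by positivity
  have hx16 : x * 4 ≤ x ^ 2 := by nlinarith
  have hrx : x / 2 ≤ (r : ℝ) - 1 := by nlinarith
  have h1 : upperTail (s * r / √(d + r : ℕ)) ≤ b := by
    have hr0 : (0 : ℝ) ≤ r := by linarith
    refine (upperTail_le_exp (by positivity)).trans (htail _ ?_)
    rw [div_pow, Real.sq_sqrt (by positivity), le_div_iff₀ (by positivity), mul_pow]
    have e : x * ((d : ℝ) + r) ≤ 4 * (r : ℝ) ^ 2 := by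
      -- `d ≤ 4 r² / x² ≤ r² / x` and `x ≤ 2 r`.
      have e1 : (x * y / 2) ^ 2 ≤ (r : ℝ) ^ 2 := by gcongr; linarith
      have e2 : x * (d : ℝ) ≤ (x * y / 2) ^ 2 := by rw [← hyd]; nlinarith [sq_nonneg y]
      nlinarith
    push_cast
    nlinarith
  have h2 : ENNReal.ofReal (Real.exp (-(s * (r - 1) / 2) ^ 2 / 2)) ≤ b := by
    refine htail _ ?_
    have : (x / 2) ^ 2 ≤ ((r : ℝ) - 1) ^ 2 := by gcongr
    nlinarith
  have h3 : upperTail ((s * (r - (1 : ℕ)) - s * (r - 1) / 2) / √(d - (r + 1) + 1 : ℕ)) ≤ b := by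
    have hz : s * x / 4 ≤ (s * (r - (1 : ℕ)) - s * (r - 1) / 2) / √(d - (r + 1) + 1 : ℕ) := by
      have hp : 0 < √(d - (r + 1) + 1 : ℕ) := Real.sqrt_pos.2 (by positivity)
      have hle : √(d - (r + 1) + 1 : ℕ) ≤ y := Real.sqrt_le_sqrt (by
        exact_mod_cast (by omega : d - (r + 1) + 1 ≤ d))
      rw [le_div_iff₀ hp]
      calc s * x / 4 * √(d - (r + 1) + 1 : ℕ) ≤ s * x / 4 * y := by gcongr
        _ = s / 2 * (x * y / 2) := by ring
        _ ≤ s / 2 * (r - 1) := by gcongr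
        _ = _ := by push_cast; ring
    refine (upperTail_anti hz).trans ((upperTail_le_exp (by positivity)).trans
      (htail _ ?_))
    nlinarith
  have h4 : 2⁻¹ ≤ upperTail (-(s * √(1 : ℕ))) := half_le_upperTail_neg (by positivity)
  calc farBound s d r 1 (s * (r - 1) / 2) ≤ b + (b + b) / 2⁻¹ := by
        unfold farBound
        gcongr
    _ = 5 * b := by
        rw [ENNReal.div_eq_inv_mul, inv_inv]
        ring
    _ ≤ _ := by
        rw [hb, ← ENNReal.ofReal_ofNat, ← ENNReal.ofReal_mul (by norm_num)]
        refine ENNReal.ofReal_le_ofReal ?_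
        have : 1 ≤ Real.exp (s ^ 2 / 2) := Real.one_le_exp (by positivity)
        gcongr
        linarith

end Upper

/-! ### Moments as integrals of tail probabilities -/

/-- The `p`-th moment `∫_0^∞ p x ^ (p - 1) F(x) dx` of a nonnegative variable whose tail function
`x ↦ P(Z > x)` is `F`. -/
noncomputable def tailMoment (p : ℝ) (F : ℝ → ℝ≥0∞) : ℝ≥0∞ :=
  ENNReal.ofReal p * ∫⁻ x in Set.Ioi (0 : ℝ), F x * ENNReal.ofReal (x ^ (p - 1))

lemma tailMoment_mono {p : ℝ} {F G : ℝ → ℝ≥0∞} (h : ∀ x > 0, F x ≤ G x) :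
    tailMoment p F ≤ tailMoment p G := by
  refine mul_le_mul_right (setLIntegral_mono' measurableSet_Ioi fun x hx => ?_) _
  exact mul_le_mul_left (h x hx) _

section LayerCake

variable {α : Type*} [MeasurableSpace α] {μ : Measure α} {Z : α → ℝ≥0∞} {p c : ℝ}

lemma lintegral_rpow_eq_tailMoment (hZ : Measurable Z) (hfin : ∀ᵐ a ∂μ, Z a ≠ ∞) (hp : 0 < p)
    (hc : 0 < c) : ∫⁻ a, Z a ^ p ∂μ =
      ENNReal.ofReal (c ^ p) * tailMoment p fun x => μ {a | ENNReal.ofReal (x * c) < Z a} := by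
  have h := lintegral_rpow_eq_lintegral_meas_lt_mul μ (f := fun a => (Z a).toReal / c)
    (ae_of_all _ fun a => by positivity) (hZ.ennreal_toReal.div_const c).aemeasurable hp
  have e1 : ∫⁻ a, Z a ^ p ∂μ =
      ENNReal.ofReal (c ^ p) * ∫⁻ a, ENNReal.ofReal (((Z a).toReal / c) ^ p) ∂μ := by
    rw [← lintegral_const_mul' _ _ ENNReal.ofReal_ne_top]
    refine lintegral_congr_ae ?_
    filter_upwards [hfin] with a ha
    rw [← ENNReal.ofReal_mul (by positivity), Real.div_rpow ENNReal.toReal_nonneg hc.le,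
      mul_div_cancel₀ _ (by positivity),
      ← ENNReal.ofReal_rpow_of_nonneg ENNReal.toReal_nonneg hp.le, ENNReal.ofReal_toReal ha]
  rw [e1, h, tailMoment]
  congr 2
  refine setLIntegral_congr_fun measurableSet_Ioi fun x hx => ?_
  refine congrArg (· * ENNReal.ofReal (x ^ (p - 1))) (measure_congr ?_)
  filter_upwards [hfin] with a ha
  refine propext ?_
  change x < (Z a).toReal / c ↔ ENNReal.ofReal (x * c) < Z a
  rw [lt_div_iff₀ hc, ENNReal.ofReal_lt_iff_lt_toReal (mul_nonneg (le_of_lt hx) hc.le) ha]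

/-- One direction of the tail formula needs no finiteness: a variable which is infinite with
positive probability has infinite moments. -/
lemma tailMoment_le_lintegral_rpow (hZ : Measurable Z) (hp : 0 < p) (hc : 0 < c) :
    ENNReal.ofReal (c ^ p) * tailMoment p (fun x => μ {a | ENNReal.ofReal (x * c) < Z a}) ≤
      ∫⁻ a, Z a ^ p ∂μ := by
  by_cases h : ∫⁻ a, Z a ^ p ∂μ = ∞
  · rw [h]
    exact le_top
  · refine (lintegral_rpow_eq_tailMoment hZ ?_ hp hc).ge
    filter_upwards [ae_lt_top (hZ.pow_const p) h] with a ha hZa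
    rw [hZa, ENNReal.top_rpow_of_pos hp] at ha
    exact lt_irrefl _ ha

end LayerCake

/-! ### The limiting constant -/

lemma gaussianError_eq {s p : ℝ} (hs : 0 < s) (hp : 0 < p) (d : ℕ) :
    gaussianError d s p =
      ENNReal.ofReal (√d ^ p) * tailMoment p fun x => 2 * upperTail (s * x) := by
  have h := lintegral_rpow_eq_tailMoment (μ := gaussianReal 0 1) (Z := fun x => ENNReal.ofReal |x|)
    measurable_id.abs.ennreal_ofReal (ae_of_all _ fun _ => ENNReal.ofReal_ne_top) hp hs
  have hF : tailMoment p (fun x => gaussianReal 0 1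
      {a : ℝ | ENNReal.ofReal (x * s) < ENNReal.ofReal |a|}) =
      tailMoment p fun x => 2 * upperTail (s * x) := by
    unfold tailMoment
    congr 1
    refine setLIntegral_congr_fun measurableSet_Ioi fun x hx => ?_
    have hxs : 0 ≤ x * s := mul_nonneg (le_of_lt hx) hs.le
    refine congrArg (· * ENNReal.ofReal (x ^ (p - 1))) ?_
    change gaussianReal 0 1 {a : ℝ | ENNReal.ofReal (x * s) < ENNReal.ofReal |a|} =
      2 * upperTail (s * x)
    rw [mul_comm s x, ← gaussianReal_lt_abs hxs]
    congr 1
    ext a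
    exact ENNReal.ofReal_lt_ofReal_iff_of_nonneg hxs
  rw [gaussianError, h, hF, ← mul_assoc, ← ENNReal.ofReal_mul (by positivity),
    div_mul_cancel₀ _ (by positivity), Real.sqrt_eq_rpow, ← Real.rpow_mul d.cast_nonneg]
  congr 3
  ring

lemma lintegral_abs_rpow_gaussianReal_ne_zero {p : ℝ} (hp : 0 < p) :
    ∫⁻ x, ENNReal.ofReal |x| ^ p ∂(gaussianReal 0 1) ≠ 0 := by
  intro h
  have hm : Measurable fun x : ℝ => ENNReal.ofReal |x| ^ p :=
    measurable_id.abs.ennreal_ofReal.pow_const p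
  rw [lintegral_eq_zero_iff hm] at h
  have : ∀ᵐ x ∂(gaussianReal 0 1), False := by
    filter_upwards [h, ae_gaussianReal_ne 0] with x hx hx0
    simp [hp.not_gt, hx0, hp] at hx
  rw [eventually_false_iff_eq_bot, ae_eq_bot] at this
  exact NeZero.ne _ this

lemma lintegral_abs_rpow_gaussianReal_ne_top {p : ℝ} (hp : 0 < p) :
    ∫⁻ x, ENNReal.ofReal |x| ^ p ∂(gaussianReal 0 1) ≠ ∞ := by
  have h := lintegral_rpow_enorm_lt_top_of_eLpNorm_lt_top (by simpa using hp) ENNReal.ofReal_ne_top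
    (memLp_id_gaussianReal' (μ := 0) (v := 1) (ENNReal.ofReal p) ENNReal.ofReal_ne_top).2
  rw [ENNReal.toReal_ofReal hp.le] at h
  simpa [Real.enorm_eq_ofReal_abs] using h.ne

lemma tailMoment_upperTail_ne_zero {s p : ℝ} (hs : 0 < s) (hp : 0 < p) :
    tailMoment p (fun x => 2 * upperTail (s * x)) ≠ 0 := by
  intro h
  have h1 := gaussianError_eq hs hp 1
  rw [h, mul_zero, gaussianError, mul_eq_zero] at h1
  refine h1.elim (fun h2 => ?_) (lintegral_abs_rpow_gaussianReal_ne_zero hp)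
  simp only [Nat.cast_one, Real.one_rpow, ENNReal.ofReal_eq_zero] at h2
  exact absurd h2 (not_le.2 (by positivity))

lemma tailMoment_upperTail_ne_top {s p : ℝ} (hs : 0 < s) (hp : 0 < p) :
    tailMoment p (fun x => 2 * upperTail (s * x)) ≠ ∞ := by
  have h1 := gaussianError_eq hs hp 1
  rw [Nat.cast_one, Real.sqrt_one, Real.one_rpow, ENNReal.ofReal_one, one_mul] at h1
  rw [← h1]
  exact ENNReal.mul_ne_top ENNReal.ofReal_ne_top (lintegral_abs_rpow_gaussianReal_ne_top hp)

/-- Convergence of moments: tail functions which are trapped between the two limiting bounds, and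
have uniform exponential tails, have moments converging to that of `|N| / s`. -/
lemma tendsto_tailMoment {s p : ℝ} (hs : 0 < s) (hp : 1 ≤ p) {F : ℕ → ℝ → ℝ≥0∞}
    (hanti : ∀ d, Antitone (F d)) (hlow : ∀ x > 0, ∀ᶠ d in atTop, 1 - closeLimitBound s x d ≤ F d x)
    (hup : ∀ x > 0, ∀ᶠ d in atTop, F d x ≤ farLimitBound s x d)
    (hexp : ∀ d ≠ 0, ∀ x > 0, F d x ≤
      ENNReal.ofReal (5 * Real.exp (s ^ 2 / 2) * Real.exp (-(s ^ 2 / 8) * x))) :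
    Tendsto (fun d => tailMoment p (F d)) atTop
      (𝓝 (tailMoment p fun x => 2 * upperTail (s * x))) := by
  refine ENNReal.Tendsto.const_mul ?_ (Or.inr ENNReal.ofReal_ne_top)
  refine tendsto_lintegral_filter_of_dominated_convergence
    (fun x => ENNReal.ofReal (5 * Real.exp (s ^ 2 / 2)) *
      ENNReal.ofReal (x ^ (p - 1) * Real.exp (-(s ^ 2 / 8) * x ^ (1 : ℝ))))
    (Eventually.of_forall fun d => (hanti d).measurable.mul
      (measurable_id.pow_const _).ennreal_ofReal) ?_ ?_ ?_
  · filter_upwards [eventually_ne_atTop 0] with d hd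
    refine (ae_restrict_iff' measurableSet_Ioi).2 (ae_of_all _ fun x hx => ?_)
    have hx0 : 0 < x := hx
    calc F d x * ENNReal.ofReal (x ^ (p - 1))
        ≤ ENNReal.ofReal (5 * Real.exp (s ^ 2 / 2) * Real.exp (-(s ^ 2 / 8) * x)) *
          ENNReal.ofReal (x ^ (p - 1)) := mul_le_mul_left (hexp d hd x hx) _
      _ = _ := by
        rw [← ENNReal.ofReal_mul (by positivity), ← ENNReal.ofReal_mul (by positivity),
          Real.rpow_one]
        congr 1
        ring
  · rw [lintegral_const_mul' _ _ ENNReal.ofReal_ne_top]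
    exact ENNReal.mul_ne_top ENNReal.ofReal_ne_top (integrableOn_rpow_mul_exp_neg_mul_rpow
      (by linarith) one_pos (by positivity)).lintegral_lt_top.ne
  · refine (ae_restrict_iff' measurableSet_Ioi).2 (ae_of_all _ fun x hx => ?_)
    have hx0 : 0 < x := hx
    refine ENNReal.Tendsto.mul_const ?_ (Or.inr ENNReal.ofReal_ne_top)
    refine tendsto_of_tendsto_of_tendsto_of_le_of_le' ?_ (tendsto_farLimitBound hs hx0)
      (hlow x hx0) (hup x hx0)
    have h := ENNReal.Tendsto.sub (tendsto_const_nhds (x := (1 : ℝ≥0∞)))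
      (tendsto_closeLimitBound hs hx0) (Or.inl ENNReal.one_ne_top)
    rwa [centralMass_eq (by positivity), ENNReal.sub_sub_cancel ENNReal.one_ne_top
      (two_mul_upperTail_le_one (by positivity))] at h

/-! ### Comparison of the errors -/

section Errors

variable {Ω : Type*} [MeasurableSpace Ω] {P : Measure Ω} {V : ℕ → Ω → ℝ} {s ℓ : ℝ}

lemma measurable_enat {η : Ω → ℕ∞} (hη : ∀ c : ℕ, MeasurableSet {ω | η ω = c}) :
    Measurable η := by
  refine measurable_to_countable' fun c => ?_
  cases c with
  | coe c => exact hη c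
  | top =>
    have : η ⁻¹' {⊤} = (⋃ c : ℕ, {ω | η ω = c})ᶜ := by
      ext ω
      simp only [Set.mem_preimage, Set.mem_singleton_iff, Set.mem_compl_iff, Set.mem_iUnion,
        Set.mem_ofPred_eq, not_exists]
      exact ⟨fun h c => h ▸ ENat.top_ne_natCast c, fun h => by
        by_contra h'
        obtain ⟨c, hc⟩ := ENat.ne_top_iff_exists.1 h'
        exact h c hc.symm⟩
    rw [this]
    exact (MeasurableSet.iUnion hη).compl

lemma IsStandardNoise.measurable_absDiff (hN : IsStandardNoise P V) {d : ℕ}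
    {η : Ω → WithTop ℕ} (hη : IsStoppingTime (observationFiltration hN.measurable s d) η) :
    Measurable fun ω => absDiff (η ω) (passageTime V s ℓ ω) := by
  have h1 : Measurable (β := ℕ∞) η :=
    measurable_enat fun c => Filtration.le _ c _ (hη.measurableSet_eq c)
  have h2 : Measurable (β := ℕ∞) (passageTime V s ℓ) :=
    measurable_enat fun c => hN.measurableSet_eq c
  exact (Measurable.of_discrete (f := fun x : ℕ∞ × ℕ∞ => absDiff x.1 x.2)).comp (h1.prodMk h2)

/-- The smallest probability with which a rule misses the passage time by more than `x √d`. The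
infimum is taken for each `x` separately. -/
noncomputable def optimalMiss (P : Measure Ω) {V : ℕ → Ω → ℝ} (hV : ∀ i, Measurable (V i))
    (s ℓ : ℝ) (d : ℕ) (x : ℝ) : ℝ≥0∞ :=
  ⨅ (η : Ω → WithTop ℕ) (_ : IsStoppingTime (observationFiltration hV s d) η),
    P {ω | ENNReal.ofReal (x * √d) < absDiff (η ω) (passageTime V s ℓ ω)}

/-- The probability with which the delayed rule misses the passage time by more than `x √d`. -/
noncomputable def ruleMiss (P : Measure Ω) (V : ℕ → Ω → ℝ) (s ℓ : ℝ) (d : ℕ) (x : ℝ) : ℝ≥0∞ :=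
  P {ω | ENNReal.ofReal (x * √d) <
    absDiff (delayedRuleFrom d V s ℓ d ω) (passageTime V s ℓ ω)}

lemma measure_lt_anti (Z : Ω → ℝ≥0∞) {c : ℝ} (hc : 0 ≤ c) :
    Antitone fun x : ℝ => P {ω | ENNReal.ofReal (x * c) < Z ω} := fun _ _ h =>
  measure_mono fun _ hω =>
    lt_of_le_of_lt (ENNReal.ofReal_le_ofReal (mul_le_mul_of_nonneg_right h hc)) hω

lemma ruleMiss_anti (d : ℕ) : Antitone (ruleMiss P V s ℓ d) :=
  measure_lt_anti _ (Real.sqrt_nonneg d)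

lemma optimalMiss_anti (hV : ∀ i, Measurable (V i)) (d : ℕ) :
    Antitone (optimalMiss P hV s ℓ d) := fun _ _ h =>
  iInf₂_mono fun _ _ => measure_lt_anti _ (Real.sqrt_nonneg d) h

lemma optimalMiss_le_ruleMiss (hV : ∀ i, Measurable (V i)) (d : ℕ) (x : ℝ) :
    optimalMiss P hV s ℓ d x ≤ ruleMiss P V s ℓ d x :=
  iInf₂_le _ (isStoppingTime_delayedRuleFrom hV d)

lemma optimalError_le (hV : ∀ i, Measurable (V i)) (p : ℝ) (d : ℕ) :
    optimalError P hV s ℓ p d ≤ trackingError P V s ℓ p (delayedRuleFrom d V s ℓ d) :=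
  iInf₂_le _ (isStoppingTime_delayedRuleFrom hV d)

lemma IsStandardNoise.tailMoment_optimalMiss_le (hN : IsStandardNoise P V) {p : ℝ} (hp : 0 < p)
    {d : ℕ} (hd : d ≠ 0) :
    ENNReal.ofReal (√d ^ p) * tailMoment p (optimalMiss P hN.measurable s ℓ d) ≤
      optimalError P hN.measurable s ℓ p d := by
  refine le_iInf₂ fun η hη => ?_
  refine le_trans (mul_le_mul_right (tailMoment_mono fun x _ => iInf₂_le η hη) _)
    (tailMoment_le_lintegral_rpow (hN.measurable_absDiff hη) hp ?_)
  exact Real.sqrt_pos.2 (by exact_mod_cast Nat.pos_of_ne_zero hd)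

variable [IsProbabilityMeasure P]

/-- The delayed rule and the passage time are almost surely finite, so that the tail formula is an
equality for the error of the delayed rule. -/
lemma IsStandardNoise.trackingError_delayedRuleFrom (hN : IsStandardNoise P V) (hs : 0 < s)
    {p : ℝ} (hp : 0 < p) {d : ℕ} (hd : d ≠ 0) :
    trackingError P V s ℓ p (delayedRuleFrom d V s ℓ d) =
      ENNReal.ofReal (√d ^ p) * tailMoment p (ruleMiss P V s ℓ d) := by
  refine lintegral_rpow_eq_tailMoment
    (hN.measurable_absDiff (isStoppingTime_delayedRuleFrom hN.measurable d)) ?_ hp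
    (Real.sqrt_pos.2 (by exact_mod_cast Nat.pos_of_ne_zero hd))
  have h1 : ∀ a, ∀ᵐ ω ∂P, passageTime V s a ω ≠ ⊤ := fun a =>
    measure_eq_zero_iff_ae_notMem.1 (hN.measure_passageTime_eq_top (ℓ := a) hs)
  filter_upwards [h1 ℓ, h1 (ℓ - s * d)] with ω hω hω'
  rw [delayedRuleFrom_eq]
  obtain ⟨j, hj⟩ := WithTop.ne_top_iff_exists.1 hω
  obtain ⟨k, hk⟩ := WithTop.ne_top_iff_exists.1 hω'
  rw [← hj, ← hk]
  exact absDiff_natCast_ne_top (k + d) j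

lemma IsStandardNoise.eventually_le_optimalMiss (hN : IsStandardNoise P V) {ℓ : ℕ → ℝ}
    (hs : 0 < s) (hℓ : ∀ d : ℕ, s * d ≤ ℓ d) {x : ℝ} (hx : 0 ≤ x) :
    ∀ᶠ d in atTop, 1 - closeLimitBound s x d ≤ optimalMiss P hN.measurable s (ℓ d) d x := by
  filter_upwards [hN.eventually_measure_absDiff_le hs hx] with d hd
  refine le_iInf₂ fun η hη => tsub_le_iff_right.2 ?_
  have hcompl : {ω | ENNReal.ofReal (x * √d) < absDiff (η ω) (passageTime V s (ℓ d) ω)}ᶜ =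
      {ω | absDiff (η ω) (passageTime V s (ℓ d) ω) ≤ ENNReal.ofReal (x * √d)} := by
    ext ω
    exact not_lt (α := ℝ≥0∞)
  calc (1 : ℝ≥0∞) = P {ω | ENNReal.ofReal (x * √d) < absDiff (η ω) (passageTime V s (ℓ d) ω)} +
        P {ω | absDiff (η ω) (passageTime V s (ℓ d) ω) ≤ ENNReal.ofReal (x * √d)} := by
        rw [← hcompl, prob_add_prob_compl
          (measurableSet_lt measurable_const (hN.measurable_absDiff hη))]
    _ ≤ _ := by
        gcongr
        exact hd (ℓ d) (hℓ d) η hη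

lemma IsStandardNoise.tendsto_tailMoment_optimalMiss (hN : IsStandardNoise P V) {ℓ : ℕ → ℝ}
    (hs : 0 < s) (hℓ : ∀ d : ℕ, s * d ≤ ℓ d) {p : ℝ} (hp : 1 ≤ p) :
    Tendsto (fun d => tailMoment p (optimalMiss P hN.measurable s (ℓ d) d)) atTop
      (𝓝 (tailMoment p fun x => 2 * upperTail (s * x))) := by
  refine tendsto_tailMoment hs hp (fun d => optimalMiss_anti _ d)
    (fun x hx => hN.eventually_le_optimalMiss hs hℓ hx.le) (fun x hx => ?_) fun d hd x hx => ?_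
  · filter_upwards [hN.eventually_measure_rule_le hs hx.le] with d hd
    exact (optimalMiss_le_ruleMiss _ d x).trans (hd _ (hℓ d))
  · exact (optimalMiss_le_ruleMiss _ d x).trans (hN.measure_rule_le_exp hs hx.le hd (hℓ d))

lemma IsStandardNoise.tendsto_tailMoment_ruleMiss (hN : IsStandardNoise P V) {ℓ : ℕ → ℝ}
    (hs : 0 < s) (hℓ : ∀ d : ℕ, s * d ≤ ℓ d) {p : ℝ} (hp : 1 ≤ p) :
    Tendsto (fun d => tailMoment p (ruleMiss P V s (ℓ d) d)) atTop
      (𝓝 (tailMoment p fun x => 2 * upperTail (s * x))) := by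
  refine tendsto_tailMoment hs hp (fun d => ruleMiss_anti d) (fun x hx => ?_) (fun x hx => ?_)
    fun d hd x hx => hN.measure_rule_le_exp hs hx.le hd (hℓ d)
  · filter_upwards [hN.eventually_le_optimalMiss hs hℓ hx.le] with d hd
    exact hd.trans (optimalMiss_le_ruleMiss _ d x)
  · filter_upwards [hN.eventually_measure_rule_le hs hx.le] with d hd
    exact hd _ (hℓ d)

lemma AsympEq.of_tendsto {a b u v : ℕ → ℝ≥0∞} {I : ℝ≥0∞} (hI : I ≠ 0) (hI' : I ≠ ∞)
    (hu : Tendsto u atTop (𝓝 I)) (hv : Tendsto v atTop (𝓝 I)) {c : ℕ → ℝ≥0∞}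
    (hc : ∀ d ≠ 0, c d ≠ 0 ∧ c d ≠ ∞) (ha : ∀ d ≠ 0, a d = c d * u d)
    (hb : ∀ d ≠ 0, b d = c d * v d) : AsympEq a b := by
  have h := ENNReal.Tendsto.div hu (Or.inl hI) hv (Or.inl hI')
  rw [ENNReal.div_self hI hI'] at h
  refine h.congr' ?_
  filter_upwards [eventually_ne_atTop 0] with d hd
  rw [ha d hd, hb d hd, ENNReal.mul_div_mul_left _ _ (hc d hd).1 (hc d hd).2]

/-- The three asymptotic relations for the rule which waits for the delayed observation to reach
`ℓ - s d` after time `d`. -/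
lemma IsStandardNoise.asympEq (hN : IsStandardNoise P V) {ℓ : ℕ → ℝ} (hs : 0 < s)
    (hℓ : ∀ d : ℕ, s * d ≤ ℓ d) {p : ℝ} (hp : 1 ≤ p) :
    AsympEq (fun d => optimalError P hN.measurable s (ℓ d) p d) (fun d => gaussianError d s p) ∧
    AsympEq (fun d => optimalError P hN.measurable s (ℓ d) p d)
      (fun d => trackingError P V s (ℓ d) p (delayedRuleFrom d V s (ℓ d) d)) ∧
    AsympEq (fun d => trackingError P V s (ℓ d) p (delayedRuleFrom d V s (ℓ d) d))
      (fun d => gaussianError d s p) := by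
  have hp0 : 0 < p := by linarith
  set I := tailMoment p fun x => 2 * upperTail (s * x)
  have hI : I ≠ 0 := tailMoment_upperTail_ne_zero hs hp0
  have hI' : I ≠ ∞ := tailMoment_upperTail_ne_top hs hp0
  let c : ℕ → ℝ≥0∞ := fun d => ENNReal.ofReal (√d ^ p)
  have hc : ∀ d ≠ 0, c d ≠ 0 ∧ c d ≠ ∞ := fun d hd => by
    have : 0 < √(d : ℝ) := Real.sqrt_pos.2 (by exact_mod_cast Nat.pos_of_ne_zero hd)
    refine ⟨?_, ENNReal.ofReal_ne_top⟩
    exact (ENNReal.ofReal_pos.2 (by positivity)).ne'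
  -- The normalized optimal error is squeezed between the moments of the two tail functions.
  let u : ℕ → ℝ≥0∞ := fun d => optimalError P hN.measurable s (ℓ d) p d / c d
  have hopt : ∀ d ≠ 0, optimalError P hN.measurable s (ℓ d) p d = c d * u d := fun d hd =>
    (ENNReal.mul_div_cancel (hc d hd).1 (hc d hd).2).symm
  have hrule : ∀ d ≠ 0, trackingError P V s (ℓ d) p (delayedRuleFrom d V s (ℓ d) d) =
      c d * tailMoment p (ruleMiss P V s (ℓ d) d) := fun d hd =>
    hN.trackingError_delayedRuleFrom hs hp0 hd
  have hgauss : ∀ d ≠ 0, gaussianError d s p = c d * I := fun d _ => gaussianError_eq hs hp0 d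
  have hruleI := hN.tendsto_tailMoment_ruleMiss hs hℓ hp
  have huI : Tendsto u atTop (𝓝 I) := by
    refine tendsto_of_tendsto_of_tendsto_of_le_of_le'
      (hN.tendsto_tailMoment_optimalMiss hs hℓ hp) hruleI ?_ ?_
    · filter_upwards [eventually_ne_atTop 0] with d hd
      rw [ENNReal.le_div_iff_mul_le (Or.inl (hc d hd).1) (Or.inl (hc d hd).2), mul_comm]
      exact hN.tailMoment_optimalMiss_le hp0 hd
    · filter_upwards [eventually_ne_atTop 0] with d hd
      rw [ENNReal.div_le_iff (hc d hd).1 (hc d hd).2, mul_comm, ← hrule d hd]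
      exact optimalError_le _ p d
  exact ⟨.of_tendsto hI hI' huI tendsto_const_nhds hc hopt hgauss,
    .of_tendsto hI hI' huI hruleI hc hopt hrule,
    .of_tendsto hI hI' hruleI tendsto_const_nhds hc hrule hgauss⟩

end Errors

end DelayedTracking

theorem theorem4 {Ω : Type*} [MeasurableSpace Ω] (P : Measure Ω) [IsProbabilityMeasure P]
    (V : ℕ → Ω → ℝ) (hV : ∀ i, Measurable (V i))
    (hindep : iIndepFun V P) (hlaw : ∀ i, HasLaw (V i) (gaussianReal 0 1) P)
    (s : ℝ) (hs : 0 < s) (p : ℝ) (hp : 1 ≤ p)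
    (ℓ : ℕ → ℝ) (hℓ : ∀ d : ℕ, s * d ≤ ℓ d) :
    -- the optimal error, for every threshold `ℓ d ≥ s d`
    DelayedTracking.AsympEq
      (fun d => DelayedTracking.optimalError P hV s (ℓ d) p d)
      (fun d => DelayedTracking.gaussianError d s p) ∧
    -- optimality of the first time `t ≥ d` with `Y_t ≥ ℓ - s d`, for every `ℓ d ≥ s d`
    (DelayedTracking.AsympEq
        (fun d => DelayedTracking.optimalError P hV s (ℓ d) p d)
        (fun d => DelayedTracking.trackingError P V s (ℓ d) p
          (DelayedTracking.delayedRuleFrom d V s (ℓ d) d)) ∧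
      DelayedTracking.AsympEq
        (fun d => DelayedTracking.trackingError P V s (ℓ d) p
          (DelayedTracking.delayedRuleFrom d V s (ℓ d) d))
        (fun d => DelayedTracking.gaussianError d s p)) ∧
    -- optimality of the first time `t ≥ 0` with `Y_t ≥ ℓ - s d`, if `ℓ d > s d` for large `d`
    ((∀ᶠ d : ℕ in atTop, s * d < ℓ d) →
      DelayedTracking.AsympEq
        (fun d => DelayedTracking.optimalError P hV s (ℓ d) p d)
        (fun d => DelayedTracking.trackingError P V s (ℓ d) p
          (DelayedTracking.delayedRuleFrom 0 V s (ℓ d) d)) ∧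
      DelayedTracking.AsympEq
        (fun d => DelayedTracking.trackingError P V s (ℓ d) p
          (DelayedTracking.delayedRuleFrom 0 V s (ℓ d) d))
        (fun d => DelayedTracking.gaussianError d s p)) := by
  have hN : DelayedTracking.IsStandardNoise P V := ⟨hV, hindep, hlaw⟩
  obtain ⟨h1, h2, h3⟩ := hN.asympEq hs hℓ hp
  refine ⟨h1, ⟨h2, h3⟩, fun hlt => ?_⟩
  have e : ∀ᶠ d : ℕ in atTop,
      DelayedTracking.delayedRuleFrom 0 V s (ℓ d) d =
        DelayedTracking.delayedRuleFrom d V s (ℓ d) d :=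
    hlt.mono fun d hd => DelayedTracking.delayedRuleFrom_zero_eq hd
  refine ⟨Tendsto.congr' ?_ h2, Tendsto.congr' ?_ h3⟩
  · filter_upwards [e] with d hd
    rw [hd]
  · filter_upwards [e] with d hd
    rw [hd]
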